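/- Theorem. Let $E$ be a real Banach space, let $X$ be a real Banach lattice, let $1\le p\le\infty$, and let $p^*$ be the conjugate exponent, $\frac1p+\frac1{p^*}=1$. Operators are bounded and linear, $E^*$ is the dual of $E$, and the higher duals $X^{*},X^{**},\dots$ carry the canonical dual norm and dual order. Notation. For a Banach space $F$ and a sequence $(u_j)_{j\ge1}$ in $F$ put $\|(u_j)\|_p=\big(\sum_j\|u_j\|^p\big)^{1/p}$ (read as $\sup_j\|u_j\|$ if $p=\infty$) and $\|(u_j)\|_p^w=\sup_{f\in F^*,\,\|f\|\le1}\|(f(u_j))_j\|_p$. Let $l_p(F)$ be the set of all sequences with $\|(u_j)\|_p<\infty$ if $p<\infty$, and let $l_\infty(F)$ be understood as the set $c_0(F)$ of norm-null sequences. Let $l_p^w(F)$ be the set of all sequences with $\|(u_j)\|_p^w<\infty$ $(1\le p\le\infty)$. For $f\in E^*$ and $v\in F$, $f\otimes v$ is the operator $e\mapsto f(e)v$ from $E$ to $F$. An operator $S:E\to X$ is latticially $p$-nuclear if $S=\sum_{j}u_j^*\otimes x_j$ with $(u_j^*)\in l_p(E^*)$, $(x_j)\in l_{p^*}^w(X)$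 and $x_j\ge0$ for all $j$; $\widetilde\nu_p(S)$ is the infimum of $\|(u_j^*)\|_p\,\|(x_j)\|_{p^*}^w$ over all such representations. For a Banach lattice $Y$ and a Banach space $F$, an operator $T:Y\to F$ is positively $p$-nuclear if $T=\sum_j y_j^*\otimes v_j$ with $(y_j^*)\in l_{p^*}^w(Y^*)$, $y_j^*\ge0$ for all $j$, and $(v_j)\in l_p(F)$; $\widetilde\nu^p(T)$ is the infimum of $\|(y_j^*)\|_{p^*}^w\,\|(v_j)\|_p$ over all such representations. (The series converge in operator norm.) A Banach space $F$ has the approximation property (AP) if for every compact $K\subset F$ and $\varepsilon>0$ there is a finite rank operator $R$ on $F$ with $\|Ru-u\|<\varepsilon$ for all $u\in K$. A Banach lattice $Y$ has the positive metric approximation property (PMAP) if for every compact $K\subset Y$ and $\varepsilon>0$ there is a positive finite rank operator $R$ on $Y$ with $\|R\|\le1$ and $\|Ry-y\|<\varepsilon$ for all $y\in K$. Claim. Suppose that $E^*$ has the AP or that $X^{****}$ has the PMAP. If $S:E\to X$ is an operator whose adjoint $S^*:X^*\to E^*$ is positively $p$-nuclear, then $S$ is latticially $p$-nuclear and $\widetilde\nu_p(S)=\widetilde\nu^p(S^*)$.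 -/

import Mathlib

set_option maxSynthPendingDepth 3

open scoped ENNReal

noncomputable section

namespace BanachLattice

/-- The canonical order on the dual of an ordered normed space: `f ≤ g` iff `f x ≤ g x` for all
`x ≥ 0`. For a Banach lattice this is the order of the dual Banach lattice, and, by iteration, it
gives the orders of all higher duals. -/
instance dualPreorder {X : Type*} [NormedAddCommGroup X] [NormedSpace ℝ X] [Preorder X] :
    Preorder (StrongDual ℝ X) where
  le f g := ∀ x : X, 0 ≤ x → f x ≤ g x
  le_refl _ _ _ := le_rfl
  le_trans _ _ _ hfg hgh x hx := (hfg x hx).trans (hgh x hx)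

section Operators

variable {E F : Type*} [NormedAddCommGroup E] [NormedSpace ℝ E]
  [NormedAddCommGroup F] [NormedSpace ℝ F]

/-- The adjoint `S* : F* → E*`, `S* f = f ∘ S`, of a bounded operator `S : E → F`. -/
def adjointOp (S : E →L[ℝ] F) : StrongDual ℝ F →L[ℝ] StrongDual ℝ E :=
  ContinuousLinearMap.precomp ℝ S

theorem adjointOp_apply (S : E →L[ℝ] F) (f : StrongDual ℝ F) (e : E) :
    adjointOp S f e = f (S e) := rfl

/-- The elementary tensor `f ⊗ v : E → F`, `e ↦ f(e) v`. -/
def tensorOp (f : StrongDual ℝ E) (v : F) : E →L[ℝ] F := f.smulRight v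

theorem tensorOp_apply (f : StrongDual ℝ E) (v : F) (e : E) : tensorOp f v e = f e • v := rfl

/-- Finite rank operators. -/
def IsFiniteRank (S : E →L[ℝ] F) : Prop :=
  FiniteDimensional ℝ (LinearMap.range (S : E →ₗ[ℝ] F))

/-- Positive operators. -/
def IsPositiveOp [Preorder E] [Preorder F] (S : E →L[ℝ] F) : Prop :=
  ∀ x : E, 0 ≤ x → 0 ≤ S x

end Operators

/-- The approximation property. -/
def HasAP (E : Type*) [NormedAddCommGroup E] [NormedSpace ℝ E] : Prop :=
  ∀ ε : ℝ, 0 < ε → ∀ K : Set E, IsCompact K →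
    ∃ S : E →L[ℝ] E, IsFiniteRank S ∧ ∀ u ∈ K, ‖S u - u‖ < ε

/-- The positive metric approximation property. -/
def HasPMAP (X : Type*) [NormedAddCommGroup X] [NormedSpace ℝ X] [Preorder X] : Prop :=
  ∀ ε : ℝ, 0 < ε → ∀ K : Set X, IsCompact K →
    ∃ R : X →L[ℝ] X, IsFiniteRank R ∧ IsPositiveOp R ∧ ‖R‖ ≤ 1 ∧ ∀ x ∈ K, ‖R x - x‖ < ε

section Sequences

variable {F : Type*} [NormedAddCommGroup F] [NormedSpace ℝ F]

/-- `‖(u_j)‖_p = (∑ ‖u_j‖ ^ p) ^ (1 / p)`, read as `sup_j ‖u_j‖` for `p = ∞`; the value is `∞` if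
the sum diverges. -/
def strongNorm (p : ℝ≥0∞) (u : ℕ → F) : ℝ≥0∞ :=
  if p = ∞ then ⨆ j, ‖u j‖ₑ else (∑' j, ‖u j‖ₑ ^ p.toReal) ^ (1 / p.toReal)

/-- `‖(u_j)‖_p^w = sup {‖(f(u_j))_j‖_p : f ∈ F*, ‖f‖ ≤ 1}`. -/
def weakNorm (p : ℝ≥0∞) (u : ℕ → F) : ℝ≥0∞ :=
  ⨆ (f : StrongDual ℝ F) (_ : ‖f‖ ≤ 1), strongNorm p (fun j => f (u j))

/-- `p`-summable sequences: `l_p(F)` for `p < ∞`, and the norm-null sequences `c_0(F)` for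
`p = ∞`. -/
def IsPSummable (p : ℝ≥0∞) (u : ℕ → F) : Prop :=
  strongNorm p u < ∞ ∧ (p = ∞ → Filter.Tendsto u Filter.atTop (nhds 0))

/-- Weakly `p`-summable sequences `l_p^w(F)`. -/
def IsWeaklyPSummable (p : ℝ≥0∞) (u : ℕ → F) : Prop :=
  weakNorm p u < ∞

end Sequences

section Nuclear

variable {E X : Type*} [NormedAddCommGroup E] [NormedSpace ℝ E]
  [NormedAddCommGroup X] [NormedSpace ℝ X] [Preorder X]

/-- `S = ∑ u_j ⊗ x_j` with `(u_j)` in `l_p(E*)` and `(x_j)` positive and in `l_{p*}^w(X)`. -/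
structure IsLatticiallyNuclearRep (p : ℝ≥0∞) (S : E →L[ℝ] X)
    (u : ℕ → StrongDual ℝ E) (x : ℕ → X) : Prop where
  summable_left : IsPSummable p u
  summable_right : IsWeaklyPSummable p.conjExponent x
  nonneg : ∀ j, 0 ≤ x j
  hasSum : HasSum (fun j => tensorOp (u j) (x j)) S

/-- `S : E → X` is latticially `p`-nuclear. -/
def IsLatticiallyNuclear (p : ℝ≥0∞) (S : E →L[ℝ] X) : Prop :=
  ∃ u x, IsLatticiallyNuclearRep p S u x

/-- The latticially `p`-nuclear norm (`∞` if `S` is not latticially `p`-nuclear). -/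
def latticiallyNuclearNorm (p : ℝ≥0∞) (S : E →L[ℝ] X) : ℝ≥0∞ :=
  ⨅ (u : ℕ → StrongDual ℝ E) (x : ℕ → X) (_ : IsLatticiallyNuclearRep p S u x),
    strongNorm p u * weakNorm p.conjExponent x

/-- `T = ∑ x_j ⊗ u_j` with `(x_j)` positive and in `l_{p*}^w(X*)` and `(u_j)` in `l_p(E)`. -/
structure IsPositivelyNuclearRep (p : ℝ≥0∞) (T : X →L[ℝ] E)
    (x : ℕ → StrongDual ℝ X) (u : ℕ → E) : Prop where
  summable_left : IsWeaklyPSummable p.conjExponent x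
  nonneg : ∀ j, 0 ≤ x j
  summable_right : IsPSummable p u
  hasSum : HasSum (fun j => tensorOp (x j) (u j)) T

/-- `T : X → E` is positively `p`-nuclear. -/
def IsPositivelyNuclear (p : ℝ≥0∞) (T : X →L[ℝ] E) : Prop :=
  ∃ x u, IsPositivelyNuclearRep p T x u

/-- The positively `p`-nuclear norm (`∞` if `T` is not positively `p`-nuclear). -/
def positivelyNuclearNorm (p : ℝ≥0∞) (T : X →L[ℝ] E) : ℝ≥0∞ :=
  ⨅ (x : ℕ → StrongDual ℝ X) (u : ℕ → E) (_ : IsPositivelyNuclearRep p T x u),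
    weakNorm p.conjExponent x * strongNorm p u

end Nuclear

end BanachLattice

end

/-! Let `J : X → X**` be the canonical embedding. The adjoint of `S` and `J ∘ S` are the same
bilinear form on `X* × E`, so positively `p`-nuclear representations of the adjoint are latticially
`p`-nuclear representations of `J ∘ S` with the factors exchanged
(`isPositivelyNuclearRep_adjointOp_iff`). Since `J` is a positive contraction, the claim reduces to
bounding the nuclear norm of `S` by that of `J ∘ S` (`latticiallyNuclearNorm_le_bidual`).

This is done by duality. For `k ≥ 0` the splitting norm of `t : E → X**` is the infimum over `s : E
→ X` of the nuclear norm of `s` plus `k` times that of `t - J ∘ s`. By Hahn-Banach its value at `J ∘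
S` is the trace of `J ∘ S` against a form `B` on `E* × X**` that has constant `k`, but constant `1`
on `E* × X`. The restriction to `E* × X` extends canonically to a form `B'` on `E* × X**`, still
with constant `1` (`IsBoundedForm.bidual`, a positive form of local reflexivity obtained from a
Hahn-Banach theorem on cones).

The difference `B - B'` vanishes on `E* × X`, and its trace on `J ∘ S` is zero
(`tsum_form_eq_zero_of_vanish`). If `E*` has the AP, this is the vanishing of the trace of a nuclear
representation of zero on `E*`. If `X****` has the PMAP, traces in `X****` can be compared through
positive finite rank contractions, and the two embeddings `X** → X****` agree on `X`.

Hence the splitting norm of `J ∘ S` is at most its nuclear norm, whatever `k` is. A large `k` gives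
`s : E → X` of nearly optimal norm with `J ∘ (S - s)` as small as desired; iterating writes `S` as a
series of nuclear operators into `X` whose representations are joined into one. -/

namespace BanachLattice

/-! ### Sums in `ℓ_p` of extended nonnegative numbers: Hölder, duality, tails -/

section LpSum

variable {ι κ : Type*} {p q : ℝ≥0∞}

/-- The `ℓ_p` norm of a family of extended nonnegative numbers. -/
noncomputable def lpSum (p : ℝ≥0∞) (a : ι → ℝ≥0∞) : ℝ≥0∞ :=
  if p = ∞ then ⨆ j, a j else (∑' j, a j ^ p.toReal) ^ (1 / p.toReal)

theorem lpSum_top (a : ι → ℝ≥0∞) : lpSum ∞ a = ⨆ j, a j := if_pos rfl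

theorem lpSum_of_ne_top (hp : p ≠ ∞) (a : ι → ℝ≥0∞) :
    lpSum p a = (∑' j, a j ^ p.toReal) ^ (1 / p.toReal) := if_neg hp

theorem strongNorm_eq_lpSum {F : Type*} [NormedAddCommGroup F] (p : ℝ≥0∞) (u : ℕ → F) :
    strongNorm p u = lpSum p (fun j => ‖u j‖ₑ) := rfl

theorem one_le_toReal (hp : 1 ≤ p) (hpt : p ≠ ∞) : 1 ≤ p.toReal := by
  simpa using ENNReal.toReal_mono hpt hp

theorem lpSum_mono {a b : ι → ℝ≥0∞} (h : ∀ j, a j ≤ b j) : lpSum p a ≤ lpSum p b := by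
  unfold lpSum
  split_ifs
  · exact iSup_mono h
  · gcongr
    exact h _

theorem lpSum_rpow (hp : 1 ≤ p) (hpt : p ≠ ∞) (a : ι → ℝ≥0∞) :
    lpSum p a ^ p.toReal = ∑' j, a j ^ p.toReal := by
  have := one_le_toReal hp hpt
  rw [lpSum_of_ne_top hpt, ← ENNReal.rpow_mul, one_div_mul_cancel (by positivity),
    ENNReal.rpow_one]

theorem lpSum_le_iff (hp : 1 ≤ p) (hpt : p ≠ ∞) {a : ι → ℝ≥0∞} {c : ℝ≥0∞} :
    lpSum p a ≤ c ↔ ∑' j, a j ^ p.toReal ≤ c ^ p.toReal := by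
  have := one_le_toReal hp hpt
  rw [← lpSum_rpow hp hpt, ENNReal.rpow_le_rpow_iff (by positivity)]

theorem le_lpSum (hp : 1 ≤ p) (a : ι → ℝ≥0∞) (j : ι) : a j ≤ lpSum p a := by
  by_cases hpt : p = ∞
  · subst hpt
    rw [lpSum_top]
    exact le_iSup a j
  · have := one_le_toReal hp hpt
    rw [← ENNReal.rpow_le_rpow_iff (z := p.toReal) (by positivity), lpSum_rpow hp hpt]
    exact ENNReal.le_tsum (f := fun j => a j ^ p.toReal) j

theorem lpSum_const_mul (hp : 1 ≤ p) (c : ℝ≥0∞) (a : ι → ℝ≥0∞) :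
    lpSum p (fun j => c * a j) = c * lpSum p a := by
  by_cases hpt : p = ∞
  · subst hpt
    simp [lpSum_top, ENNReal.mul_iSup]
  · have := one_le_toReal hp hpt
    simp_rw [lpSum_of_ne_top hpt, ENNReal.mul_rpow_of_nonneg _ _ ENNReal.toReal_nonneg,
      ENNReal.tsum_mul_left]
    rw [ENNReal.mul_rpow_of_nonneg _ _ (by positivity), ← ENNReal.rpow_mul,
      mul_one_div_cancel (by positivity), ENNReal.rpow_one]

theorem lpSum_equiv (e : κ ≃ ι) (a : ι → ℝ≥0∞) : lpSum p (fun j => a (e j)) = lpSum p a := by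
  unfold lpSum
  rw [e.iSup_comp (g := a), e.tsum_eq (fun j => a j ^ p.toReal)]

theorem lpSum_prod (hp : 1 ≤ p) (a : ι × κ → ℝ≥0∞) :
    lpSum p a = lpSum p (fun i => lpSum p (fun k => a (i, k))) := by
  by_cases hpt : p = ∞
  · subst hpt
    simp [lpSum_top, iSup_prod]
  · rw [lpSum_of_ne_top hpt, lpSum_of_ne_top hpt]
    simp_rw [lpSum_rpow hp hpt]
    rw [← ENNReal.tsum_prod (f := fun i k => a (i, k) ^ p.toReal)]

/-- Each term is at most the total `T`, so `a ^ p ≤ T ^ (p - 1) * a`. This later allows summable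
weights to serve all exponents at once. -/
theorem lpSum_le_tsum (hp : 1 ≤ p) (a : ι → ℝ≥0∞) : lpSum p a ≤ ∑' j, a j := by
  by_cases hpt : p = ∞
  · subst hpt
    rw [lpSum_top]
    exact iSup_le ENNReal.le_tsum
  · have h1 := one_le_toReal hp hpt
    rw [lpSum_le_iff hp hpt]
    set T := ∑' j, a j with hT
    have key : ∀ t : ℝ≥0∞, t ^ p.toReal = t ^ (p.toReal - 1) * t := fun t => by
      nth_rewrite 3 [← ENNReal.rpow_one t]
      rw [← ENNReal.rpow_add_of_nonneg _ _ (by linarith) zero_le_one, sub_add_cancel]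
    calc ∑' j, a j ^ p.toReal ≤ ∑' j, T ^ (p.toReal - 1) * a j := by
          refine ENNReal.tsum_le_tsum fun j => ?_
          rw [key]
          exact mul_le_mul_left (ENNReal.rpow_le_rpow (ENNReal.le_tsum j) (by linarith)) _
      _ = T ^ p.toReal := by rw [ENNReal.tsum_mul_left, ← hT, ← key]

theorem toReal_holderConjugate (hpq : p.HolderConjugate q) (hpt : p ≠ ∞) (hqt : q ≠ ∞) :
    p.toReal.HolderConjugate q.toReal := by
  have hp := one_le_toReal (ENNReal.HolderConjugate.one_le p q) hpt
  have hq := one_le_toReal (ENNReal.HolderConjugate.one_le q p) hqt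
  simpa using ENNReal.HolderTriple.toReal (p := p) (q := q) 1 (by linarith) (by linarith)

theorem sum_mul_le_lpSum_mul_lpSum (hpq : p.HolderConjugate q) (s : Finset ι)
    (a b : ι → ℝ≥0∞) : ∑ j ∈ s, a j * b j ≤ lpSum p a * lpSum q b := by
  have hp : 1 ≤ p := ENNReal.HolderConjugate.one_le p q
  have hq : 1 ≤ q := ENNReal.HolderConjugate.one_le q p
  by_cases hpt : p = ∞
  · have hq1 : q = 1 := (ENNReal.HolderConjugate.eq_top_iff_eq_one p q).1 hpt
    subst hpt hq1
    rw [lpSum_of_ne_top (by simp) b]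
    simp only [lpSum_top, ENNReal.toReal_one, ENNReal.rpow_one, div_one]
    calc ∑ j ∈ s, a j * b j ≤ ∑ j ∈ s, (⨆ j, a j) * b j := by
          gcongr
          exact le_iSup a _
      _ ≤ (⨆ j, a j) * ∑' j, b j := by
          rw [← Finset.mul_sum]
          gcongr
          exact ENNReal.sum_le_tsum s
  by_cases hqt : q = ∞
  · have hp1 : p = 1 := (ENNReal.HolderConjugate.eq_top_iff_eq_one q p).1 hqt
    subst hqt hp1
    rw [lpSum_of_ne_top (by simp) a]
    simp only [lpSum_top, ENNReal.toReal_one, ENNReal.rpow_one, div_one]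
    calc ∑ j ∈ s, a j * b j ≤ ∑ j ∈ s, a j * (⨆ j, b j) := by
          gcongr
          exact le_iSup b _
      _ ≤ (∑' j, a j) * (⨆ j, b j) := by
          rw [← Finset.sum_mul]
          gcongr
          exact ENNReal.sum_le_tsum s
  have hr : p.toReal.HolderConjugate q.toReal :=
    toReal_holderConjugate hpq hpt hqt
  refine (ENNReal.inner_le_Lp_mul_Lq s a b hr).trans ?_
  rw [lpSum_of_ne_top hpt, lpSum_of_ne_top hqt]
  gcongr <;> exact ENNReal.sum_le_tsum s

theorem lpSum_indicator_lt_top (hp : 1 ≤ p) (s : Finset ι) (a : ι → ℝ≥0∞)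
    (ha : ∀ j, a j ≠ ∞) : lpSum p ((s : Set ι).indicator a) < ∞ := by
  refine (lpSum_le_tsum hp _).trans_lt ?_
  rw [← sum_eq_tsum_indicator]
  exact ENNReal.sum_lt_top.2 fun j _ => (ha j).lt_top

theorem exists_lpSum_indicator_compl_lt (hp : 1 ≤ p) {a : ℕ → ℝ≥0∞} (ha : lpSum p a < ∞)
    (h0 : p = ∞ → Filter.Tendsto a Filter.atTop (nhds 0)) {ε : ℝ≥0∞} (hε : 0 < ε) :
    ∃ N, lpSum p ((Set.Ici N).indicator a) < ε := by
  obtain ⟨δ, hδ, hδε⟩ := exists_between hε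
  by_cases hpt : p = ∞
  · obtain ⟨N, hN⟩ := ((h0 hpt).eventually (gt_mem_nhds hδ)).exists_forall_of_atTop
    refine ⟨N, lt_of_le_of_lt ?_ hδε⟩
    subst hpt
    rw [lpSum_top]
    refine iSup_le fun j => Set.indicator_le' (fun j hj => (hN j hj).le) (fun _ _ => zero_le) j
  · have h1 := one_le_toReal hp hpt
    have hsum : ∑' j, a j ^ p.toReal ≠ ∞ := by
      rw [← lpSum_rpow hp hpt]
      exact (ENNReal.rpow_lt_top_of_nonneg (by positivity) ha.ne).ne
    have := ENNReal.tendsto_sum_nat_add _ hsum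
    have hδ' : 0 < δ ^ p.toReal := ENNReal.rpow_pos hδ (hδε.trans_le le_top).ne
    obtain ⟨N, hN⟩ := (this.eventually (gt_mem_nhds hδ')).exists
    refine ⟨N, lt_of_le_of_lt ?_ hδε⟩
    rw [lpSum_le_iff hp hpt]
    refine le_trans (le_of_eq ?_) hN.le
    rw [← ENNReal.summable.sum_add_tsum_nat_add' (k := N)]
    rw [Finset.sum_eq_zero, zero_add]
    · refine tsum_congr fun j => ?_
      rw [Set.indicator_of_mem (by simp)]
    · intro j hj
      rw [Set.indicator_of_notMem (by simpa using hj), ENNReal.zero_rpow_of_pos (by positivity)]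

/-- Equality case of Hölder on a finite set. The extremal weights are found for the absolute values,
and the signs of `b` are then put into `a`. -/
theorem exists_dual_lpSum (hpq : p.HolderConjugate q) (s : Finset ℕ) (b : ℕ → ℝ) :
    ∃ a : ℕ → ℝ, lpSum p (fun j => ‖a j‖ₑ) ≤ 1 ∧ (∀ j ∉ s, a j = 0) ∧
      lpSum q ((s : Set ℕ).indicator fun j => ‖b j‖ₑ) ≤ ENNReal.ofReal (∑ j ∈ s, a j * b j) := by
  classical
  have hp : 1 ≤ p := ENNReal.HolderConjugate.one_le p q
  have hq : 1 ≤ q := ENNReal.HolderConjugate.one_le q p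
  -- it suffices to work with the absolute values
  suffices h : ∃ a : ℕ → NNReal, lpSum p (fun j => (a j : ℝ≥0∞)) ≤ 1 ∧ (∀ j ∉ s, a j = 0) ∧
      lpSum q ((s : Set ℕ).indicator fun j => ‖b j‖ₑ) ≤ ∑ j ∈ s, (a j : ℝ≥0∞) * ‖b j‖ₑ by
    obtain ⟨a, h1, h2, h3⟩ := h
    refine ⟨fun j => a j * SignType.sign (b j), (lpSum_mono fun j => ?_).trans h1, fun j hj => ?_,
      h3.trans (le_of_eq ?_)⟩
    · rw [enorm_mul]
      have : ‖((SignType.sign (b j) : SignType) : ℝ)‖ₑ ≤ 1 := by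
        rcases SignType.sign (b j) <;> simp
      calc _ ≤ ‖(a j : ℝ)‖ₑ * 1 := by gcongr
        _ = a j := by simp
    · simp [h2 j hj]
    · rw [ENNReal.ofReal_sum_of_nonneg]
      · refine Finset.sum_congr rfl fun j _ => ?_
        rw [mul_assoc, sign_mul_self, ENNReal.ofReal_mul (by positivity),
          Real.enorm_eq_ofReal_abs, ENNReal.ofReal_coe_nnreal]
      · intro j _
        rw [mul_assoc, sign_mul_self]
        positivity
  by_cases hqt : q = ∞
  · have hp1 : p = 1 := (ENNReal.HolderConjugate.eq_top_iff_eq_one q p).1 hqt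
    subst hqt hp1
    rcases s.eq_empty_or_nonempty with rfl | hs
    · exact ⟨0, by simp [lpSum], by simp, by simp [lpSum]⟩
    obtain ⟨i, his, hi⟩ := s.exists_max_image (fun j => ‖b j‖ₑ) hs
    refine ⟨Pi.single i 1, ?_, fun j hj => ?_, ?_⟩
    · refine (lpSum_le_tsum le_rfl _).trans ?_
      rw [tsum_eq_single i]
      · simp
      · intro j hj
        simp [hj]
    · rw [Pi.single_eq_of_ne]
      rintro rfl
      exact hj his
    · rw [lpSum_top, Finset.sum_eq_single_of_mem i his]
      · refine iSup_le fun j => ?_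
        by_cases hj : j ∈ s
        · simpa [hj] using hi j hj
        · simp [hj]
      · intro j _ hj
        simp [hj]
  by_cases hpt : p = ∞
  · have hq1 : q = 1 := (ENNReal.HolderConjugate.eq_top_iff_eq_one p q).1 hpt
    subst hpt hq1
    refine ⟨fun j => if j ∈ s then 1 else 0, ?_, fun j hj => by simp [hj], ?_⟩
    · rw [lpSum_top]
      refine iSup_le fun j => ?_
      by_cases hj : j ∈ s <;> simp [hj]
    · refine (lpSum_le_tsum le_rfl _).trans ?_
      rw [← sum_eq_tsum_indicator]
      refine le_of_eq (Finset.sum_congr rfl fun j hj => by simp [hj])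
  have hr : q.toReal.HolderConjugate p.toReal :=
    (toReal_holderConjugate hpq hpt hqt).symm
  obtain ⟨⟨a, ha1, ha2⟩, -⟩ := NNReal.isGreatest_Lp s (fun j => ‖b j‖₊) hr
  have hpp := one_le_toReal hp hpt
  have hqq := one_le_toReal hq hqt
  refine ⟨fun j => if j ∈ s then a j else 0, ?_, fun j hj => by simp [hj], ?_⟩
  · rw [lpSum_le_iff hp hpt, ENNReal.one_rpow, tsum_eq_sum (s := s)]
    · refine le_trans (le_of_eq ?_) (ENNReal.coe_le_coe.2 ha1)
      push_cast
      refine Finset.sum_congr rfl fun j hj => ?_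
      rw [if_pos hj, ENNReal.coe_rpow_of_nonneg _ (by positivity)]
    · intro j hj
      simp only [hj, if_false, ENNReal.coe_zero]
      exact ENNReal.zero_rpow_of_pos (by positivity)
  · have h1 : ∑ j ∈ s, (((if j ∈ s then a j else 0 : NNReal)) : ℝ≥0∞) * ‖b j‖ₑ
        = ((∑ j ∈ s, ‖b j‖₊ * a j : NNReal) : ℝ≥0∞) := by
      push_cast
      refine Finset.sum_congr rfl fun j hj => ?_
      rw [if_pos hj, mul_comm, enorm_eq_nnnorm]
    rw [h1, show ∑ j ∈ s, ‖b j‖₊ * a j = _ from ha2, lpSum_le_iff hq hqt,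
      ENNReal.coe_rpow_of_nonneg _ (by positivity), ← ENNReal.rpow_mul,
      one_div_mul_cancel (by positivity), ENNReal.rpow_one, tsum_eq_sum (s := s)]
    · push_cast
      refine le_of_eq (Finset.sum_congr rfl fun j hj => ?_)
      rw [Set.indicator_of_mem (by simpa using hj), ENNReal.coe_rpow_of_nonneg _ (by positivity),
        enorm_eq_nnnorm]
    · intro j hj
      rw [Set.indicator_of_notMem (by simpa using hj), ENNReal.zero_rpow_of_pos (by positivity)]

end LpSum

/-! ### The dual order as an ordered vector space -/

section DualOrder

variable {Y : Type*} [NormedAddCommGroup Y] [NormedSpace ℝ Y] [Preorder Y]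

instance dualIsOrderedAddMonoid : IsOrderedAddMonoid (StrongDual ℝ Y) where
  add_le_add_left _ _ h _ y hy := add_le_add (h y hy) le_rfl

instance dualPosSMulMono : PosSMulMono ℝ (StrongDual ℝ Y) where
  smul_le_smul_of_nonneg_left _ hc _ _ h y hy := mul_le_mul_of_nonneg_left (h y hy) hc

theorem inclusionInDoubleDual_isPositiveOp :
    IsPositiveOp (NormedSpace.inclusionInDoubleDual ℝ Y) := fun _ hx _ hf => hf _ hx

end DualOrder

/-! ### Strong and weak norms, and convergence of tensor series -/

section Norms

variable {E F G : Type*} [NormedAddCommGroup E] [NormedSpace ℝ E]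
  [NormedAddCommGroup F] [NormedSpace ℝ F] [NormedAddCommGroup G] [NormedSpace ℝ G]
  {p q : ℝ≥0∞}

theorem strongNorm_mono {u v : ℕ → F} (h : ∀ j, ‖u j‖ ≤ ‖v j‖) :
    strongNorm p u ≤ strongNorm p v :=
  lpSum_mono fun j => enorm_le_iff_norm_le.2 (h j)

theorem strongNorm_const_smul (hp : 1 ≤ p) (c : ℝ) (u : ℕ → F) :
    strongNorm p (fun j => c • u j) = ‖c‖ₑ * strongNorm p u := by
  simp only [strongNorm_eq_lpSum, enorm_smul]
  exact lpSum_const_mul hp _ _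

theorem strongNorm_indicator (s : Set ℕ) (u : ℕ → F) :
    strongNorm p (s.indicator u) = lpSum p (s.indicator fun j => ‖u j‖ₑ) := by
  rw [strongNorm_eq_lpSum]
  congr 1
  ext j
  rw [enorm_indicator_eq_indicator_enorm]

theorem strongNorm_indicator_le (s : Set ℕ) (u : ℕ → F) :
    strongNorm p (s.indicator u) ≤ strongNorm p u := by
  rw [strongNorm_indicator]
  exact lpSum_mono fun j => Set.indicator_le_self' (fun _ _ => zero_le) j

theorem le_weakNorm (y : ℕ → F) {f : StrongDual ℝ F} (hf : ‖f‖ ≤ 1) :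
    lpSum q (fun j => ‖f (y j)‖ₑ) ≤ weakNorm q y :=
  le_iSup₂ (f := fun (f : StrongDual ℝ F) (_ : ‖f‖ ≤ 1) => strongNorm q fun j => f (y j)) f hf

theorem weakNorm_le {y : ℕ → F} {c : ℝ≥0∞}
    (h : ∀ f : StrongDual ℝ F, ‖f‖ ≤ 1 → lpSum q (fun j => ‖f (y j)‖ₑ) ≤ c) :
    weakNorm q y ≤ c := iSup₂_le h

theorem weakNorm_map_le (T : F →L[ℝ] G) (hT : ‖T‖ ≤ 1) (y : ℕ → F) :
    weakNorm q (fun j => T (y j)) ≤ weakNorm q y :=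
  weakNorm_le fun f hf => le_weakNorm (f := f.comp T) y
    ((f.opNorm_comp_le T).trans (mul_le_one₀ hf (norm_nonneg _) hT))

theorem enorm_le_weakNorm (hq : 1 ≤ q) (y : ℕ → F) (j : ℕ) : ‖y j‖ₑ ≤ weakNorm q y := by
  obtain ⟨f, hf, hfy⟩ := exists_dual_vector'' ℝ (y j)
  refine le_trans (le_of_eq ?_) ((le_lpSum hq _ j).trans (le_weakNorm y hf))
  simp [hfy]

theorem weakNorm_const_smul (hq : 1 ≤ q) (c : ℝ) (y : ℕ → F) :
    weakNorm q (fun j => c • y j) = ‖c‖ₑ * weakNorm q y := by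
  simp only [weakNorm, strongNorm_eq_lpSum, map_smul, enorm_smul, lpSum_const_mul hq,
    ENNReal.mul_iSup]

theorem weakNorm_le_strongNorm (y : ℕ → F) : weakNorm q y ≤ strongNorm q y :=
  weakNorm_le fun f hf => lpSum_mono fun _ => enorm_le_iff_norm_le.2 (f.le_of_opNorm_le hf _ |>.trans
    (one_mul _).le)

theorem isPSummable_indicator (hp : 1 ≤ p) (s : Finset ℕ) (u : ℕ → F) :
    IsPSummable p ((s : Set ℕ).indicator u) := by
  refine ⟨?_, fun _ => ?_⟩
  · rw [strongNorm_indicator]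
    exact lpSum_indicator_lt_top hp s _ fun _ => enorm_ne_top
  · refine tendsto_const_nhds.congr' ?_
    filter_upwards [Filter.eventually_gt_atTop (s.sup id)] with j hj
    rw [Set.indicator_of_notMem]
    exact fun hjs => (Finset.le_sup (f := id) (Finset.mem_coe.1 hjs)).not_gt hj

theorem IsPSummable.indicator {u : ℕ → F} (hu : IsPSummable p u) (s : Set ℕ) :
    IsPSummable p (s.indicator u) :=
  ⟨(strongNorm_indicator_le s u).trans_lt hu.1, fun h =>
    squeeze_zero_norm (fun j => norm_indicator_le_norm_self u j)
      (by simpa using (hu.2 h).norm)⟩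

theorem IsPSummable.exists_tail_lt (hp : 1 ≤ p) {u : ℕ → F} (hu : IsPSummable p u) {ε : ℝ≥0∞}
    (hε : 0 < ε) : ∃ N, strongNorm p ((Set.Ici N).indicator u) < ε := by
  simp_rw [strongNorm_indicator]
  refine exists_lpSum_indicator_compl_lt hp hu.1 (fun h => ?_) hε
  simpa using (hu.2 h).enorm

theorem enorm_sum_smul_le (hpq : p.HolderConjugate q) (s : Finset ℕ) (a : ℕ → ℝ) (y : ℕ → F) :
    ‖∑ j ∈ s, a j • y j‖ₑ ≤ lpSum p (fun j => ‖a j‖ₑ) * weakNorm q y := by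
  obtain ⟨f, hf, hfy⟩ := exists_dual_vector'' ℝ (∑ j ∈ s, a j • y j)
  calc ‖∑ j ∈ s, a j • y j‖ₑ = ‖f (∑ j ∈ s, a j • y j)‖ₑ := by rw [hfy]; simp
    _ = ‖∑ j ∈ s, a j * f (y j)‖ₑ := by simp
    _ ≤ ∑ j ∈ s, ‖a j‖ₑ * ‖f (y j)‖ₑ := by
        refine (enorm_sum_le _ _).trans (le_of_eq ?_)
        simp_rw [enorm_mul]
    _ ≤ _ := (sum_mul_le_lpSum_mul_lpSum hpq s _ _).trans (by gcongr; exact le_weakNorm y hf)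

theorem opENorm_le_of_forall {T : E →L[ℝ] F} {c : ℝ≥0∞} (h : ∀ e, ‖T e‖ₑ ≤ c * ‖e‖ₑ) :
    ‖T‖ₑ ≤ c := by
  rcases eq_or_ne c ∞ with rfl | hc
  · exact le_top
  rw [← ofReal_norm]
  refine ENNReal.ofReal_le_of_le_toReal
    (T.opNorm_le_bound ENNReal.toReal_nonneg fun e => ?_)
  have := ENNReal.toReal_mono (ENNReal.mul_ne_top hc enorm_ne_top) (h e)
  simpa using this

theorem enorm_apply_le (T : E →L[ℝ] F) (e : E) : ‖T e‖ₑ ≤ ‖T‖ₑ * ‖e‖ₑ := by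
  simp only [← ofReal_norm]
  rw [← ENNReal.ofReal_mul (norm_nonneg _)]
  exact ENNReal.ofReal_le_ofReal (T.le_opNorm e)

theorem enorm_sum_tensorOp_le (hpq : p.HolderConjugate q) (s : Finset ℕ)
    (u : ℕ → StrongDual ℝ E) (x : ℕ → F) :
    ‖∑ j ∈ s, tensorOp (u j) (x j)‖ₑ ≤ strongNorm p u * weakNorm q x := by
  have hp : 1 ≤ p := ENNReal.HolderConjugate.one_le p q
  refine opENorm_le_of_forall fun e => ?_
  have h1 : lpSum p (fun j => ‖u j e‖ₑ) ≤ ‖e‖ₑ * strongNorm p u := by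
    rw [strongNorm_eq_lpSum, ← lpSum_const_mul hp]
    exact lpSum_mono fun j => (enorm_apply_le _ _).trans_eq (mul_comm _ _)
  calc ‖(∑ j ∈ s, tensorOp (u j) (x j)) e‖ₑ = ‖∑ j ∈ s, u j e • x j‖ₑ := by
        simp [tensorOp_apply]
    _ ≤ _ := enorm_sum_smul_le hpq s _ _
    _ ≤ (‖e‖ₑ * strongNorm p u) * weakNorm q x := by gcongr
    _ = _ := by ring

theorem enorm_le_of_hasSum_tensorOp (hpq : p.HolderConjugate q) {S : E →L[ℝ] F}
    {u : ℕ → StrongDual ℝ E} {x : ℕ → F} (h : HasSum (fun j => tensorOp (u j) (x j)) S) :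
    ‖S‖ₑ ≤ strongNorm p u * weakNorm q x :=
  le_of_tendsto ((continuous_enorm.tendsto S).comp h)
    (Filter.Eventually.of_forall fun s => enorm_sum_tensorOp_le hpq s u x)

theorem tensorOp_indicator (s : Set ℕ) (u : ℕ → StrongDual ℝ E) (x : ℕ → F) (j : ℕ) :
    tensorOp (s.indicator u j) (x j) = s.indicator (fun j => tensorOp (u j) (x j)) j := by
  by_cases hj : j ∈ s
  · simp [hj]
  · ext e
    simp [hj, tensorOp_apply]

/-- Hölder bounds a finite sum beyond `N` by the strong norm of the tail of `u` times the weak norm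
of `x`. For `p = ∞` the tail is small only because `u` is a null sequence. -/
theorem summable_tensorOp [CompleteSpace F] (hpq : p.HolderConjugate q)
    {u : ℕ → StrongDual ℝ E} {x : ℕ → F} (hu : IsPSummable p u) (hx : IsWeaklyPSummable q x) :
    Summable fun j => tensorOp (u j) (x j) := by
  have hp : 1 ≤ p := ENNReal.HolderConjugate.one_le p q
  rw [summable_iff_vanishing_norm]
  intro ε hε
  obtain ⟨W, hW, hW'⟩ : ∃ W : ℝ, 0 < W ∧ weakNorm q x ≤ ENNReal.ofReal W :=
    ⟨(weakNorm q x).toReal + 1, by positivity, by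
      rw [ENNReal.le_ofReal_iff_toReal_le hx.ne (by positivity)]; linarith⟩
  obtain ⟨N, hN⟩ := hu.exists_tail_lt hp (ENNReal.ofReal_pos.2 (div_pos hε hW))
  refine ⟨Finset.range N, fun t ht => ?_⟩
  have h1 : ∑ j ∈ t, tensorOp (u j) (x j)
      = ∑ j ∈ t, tensorOp ((Set.Ici N).indicator u j) (x j) := by
    refine Finset.sum_congr rfl fun j hj => ?_
    have : N ≤ j := by simpa using Finset.disjoint_left.1 ht hj
    rw [Set.indicator_of_mem (by simpa using this)]
  have h2 : ‖∑ j ∈ t, tensorOp (u j) (x j)‖ₑ < ENNReal.ofReal ε := by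
    rw [h1]
    calc _ ≤ _ := enorm_sum_tensorOp_le hpq t _ _
      _ ≤ strongNorm p ((Set.Ici N).indicator u) * ENNReal.ofReal W := by gcongr
      _ < ENNReal.ofReal (ε / W) * ENNReal.ofReal W :=
        ENNReal.mul_lt_mul_left (ENNReal.ofReal_pos.2 hW).ne' ENNReal.ofReal_ne_top hN
      _ = ENNReal.ofReal ε := by rw [← ENNReal.ofReal_mul (by positivity), div_mul_cancel₀ _ hW.ne']
  rwa [← ofReal_norm, ENNReal.ofReal_lt_ofReal_iff hε] at h2

end Norms

/-! ### The latticially nuclear norm: rescaling, joining representations, triangle inequality -/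

section NuclearNorm

variable {E Y Z : Type*} [NormedAddCommGroup E] [NormedSpace ℝ E]
  [NormedAddCommGroup Y] [NormedSpace ℝ Y] [Preorder Y]
  [NormedAddCommGroup Z] [NormedSpace ℝ Z] [Preorder Z] {p : ℝ≥0∞}

theorem one_le_conjExponent (p : ℝ≥0∞) : 1 ≤ p.conjExponent := le_self_add

theorem latticiallyNuclearNorm_le {S : E →L[ℝ] Y} {u : ℕ → StrongDual ℝ E} {x : ℕ → Y}
    (h : IsLatticiallyNuclearRep p S u x) :
    latticiallyNuclearNorm p S ≤ strongNorm p u * weakNorm p.conjExponent x :=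
  iInf₂_le_of_le u x (iInf_le _ h)

theorem isLatticiallyNuclear_of_lt_top {S : E →L[ℝ] Y}
    (h : latticiallyNuclearNorm p S < ∞) : IsLatticiallyNuclear p S := by
  obtain ⟨u, h⟩ := iInf_lt_iff.1 h
  obtain ⟨x, h⟩ := iInf_lt_iff.1 h
  obtain ⟨h, -⟩ := iInf_lt_iff.1 h
  exact ⟨u, x, h⟩

theorem enorm_le_latticiallyNuclearNorm (hp : 1 ≤ p) (S : E →L[ℝ] Y) :
    ‖S‖ₑ ≤ latticiallyNuclearNorm p S :=
  le_iInf₂ fun _ _ => le_iInf fun h => enorm_le_of_hasSum_tensorOp (.conjExponent hp) h.hasSum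

theorem IsLatticiallyNuclearRep.const_smul (hp : 1 ≤ p) {S : E →L[ℝ] Y}
    {u : ℕ → StrongDual ℝ E} {x : ℕ → Y} (h : IsLatticiallyNuclearRep p S u x) (c : ℝ) :
    IsLatticiallyNuclearRep p (c • S) (fun j => c • u j) x where
  summable_left := ⟨by
    rw [strongNorm_const_smul hp]
    exact ENNReal.mul_lt_top enorm_lt_top h.summable_left.1, fun hpt => by
    simpa using (h.summable_left.2 hpt).const_smul c⟩
  summable_right := h.summable_right
  nonneg := h.nonneg
  hasSum := by
    convert h.hasSum.const_smul c using 2 with j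
    ext e
    simp [tensorOp_apply, mul_smul]

theorem IsLatticiallyNuclearRep.rescale [PosSMulMono ℝ Y] (hp : 1 ≤ p) {S : E →L[ℝ] Y}
    {u : ℕ → StrongDual ℝ E} {x : ℕ → Y} (h : IsLatticiallyNuclearRep p S u x) {c : ℝ}
    (hc : 0 < c) :
    IsLatticiallyNuclearRep p S (fun j => c • u j) (fun j => c⁻¹ • x j) where
  summable_left := (h.const_smul hp c).summable_left
  summable_right := by
    unfold IsWeaklyPSummable
    rw [weakNorm_const_smul (one_le_conjExponent p)]
    exact ENNReal.mul_lt_top enorm_lt_top h.summable_right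
  nonneg j := smul_nonneg (by positivity) (h.nonneg j)
  hasSum := by
    convert h.hasSum using 2 with j
    ext e
    simp [tensorOp_apply, smul_smul, mul_comm c, hc.ne']

theorem IsLatticiallyNuclearRep.map {S : E →L[ℝ] Y}
    {u : ℕ → StrongDual ℝ E} {x : ℕ → Y} (h : IsLatticiallyNuclearRep p S u x)
    (T : Y →L[ℝ] Z) (hT : ‖T‖ ≤ 1) (hT' : IsPositiveOp T) :
    IsLatticiallyNuclearRep p (T ∘L S) u (fun j => T (x j)) where
  summable_left := h.summable_left
  summable_right := (weakNorm_map_le T hT x).trans_lt h.summable_right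
  nonneg j := hT' _ (h.nonneg j)
  hasSum := by
    convert h.hasSum.mapL (ContinuousLinearMap.compL ℝ E Y Z T) using 1
    · ext j e
      simp [tensorOp_apply]
    · rfl

theorem latticiallyNuclearNorm_comp_le (S : E →L[ℝ] Y) (T : Y →L[ℝ] Z) (hT : ‖T‖ ≤ 1)
    (hT' : IsPositiveOp T) :
    latticiallyNuclearNorm p (T ∘L S) ≤ latticiallyNuclearNorm p S :=
  le_iInf₂ fun _ x => le_iInf fun h => (latticiallyNuclearNorm_le (h.map T hT hT')).trans
    (by gcongr; exact weakNorm_map_le T hT x)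

theorem latticiallyNuclearNorm_smul_le (hp : 1 ≤ p) {c : ℝ} (hc : c ≠ 0) (S : E →L[ℝ] Y) :
    latticiallyNuclearNorm p (c • S) ≤ ‖c‖ₑ * latticiallyNuclearNorm p S := by
  have h0 : ‖c‖ₑ ≠ 0 := by simpa using hc
  unfold latticiallyNuclearNorm
  simp_rw [ENNReal.mul_iInf_of_ne h0 enorm_ne_top]
  refine le_iInf₂ fun u x => le_iInf fun h =>
    (latticiallyNuclearNorm_le (h.const_smul hp c)).trans_eq ?_
  rw [strongNorm_const_smul hp, mul_assoc]

theorem latticiallyNuclearNorm_neg (hp : 1 ≤ p) (S : E →L[ℝ] Y) :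
    latticiallyNuclearNorm p (-S) = latticiallyNuclearNorm p S := by
  have key : ∀ T : E →L[ℝ] Y, latticiallyNuclearNorm p (-T) ≤ latticiallyNuclearNorm p T :=
    fun T => by simpa using latticiallyNuclearNorm_smul_le hp (c := -1) (by simp) T
  exact (key S).antisymm (by simpa using key (-S))

theorem isLatticiallyNuclearRep_sum (hp : 1 ≤ p) (s : Finset ℕ) (u : ℕ → StrongDual ℝ E)
    {x : ℕ → Y} (hx : IsWeaklyPSummable p.conjExponent x) (hx0 : ∀ j, 0 ≤ x j) :
    IsLatticiallyNuclearRep p (∑ j ∈ s, tensorOp (u j) (x j)) ((s : Set ℕ).indicator u) x where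
  summable_left := isPSummable_indicator hp s u
  summable_right := hx
  nonneg := hx0
  hasSum := by
    simp_rw [tensorOp_indicator]
    exact hasSum_subtype_iff_indicator.1 (s.hasSum _)

theorem latticiallyNuclearNorm_sum_le (hp : 1 ≤ p) (s : Finset ℕ) (u : ℕ → StrongDual ℝ E)
    {x : ℕ → Y} (hx : IsWeaklyPSummable p.conjExponent x) (hx0 : ∀ j, 0 ≤ x j) :
    latticiallyNuclearNorm p (∑ j ∈ s, tensorOp (u j) (x j))
      ≤ strongNorm p u * weakNorm p.conjExponent x :=
  (latticiallyNuclearNorm_le (isLatticiallyNuclearRep_sum hp s u hx hx0)).trans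
    (by gcongr; exact strongNorm_indicator_le _ _)

theorem latticiallyNuclearNorm_zero (hp : 1 ≤ p) :
    latticiallyNuclearNorm p (0 : E →L[ℝ] Y) = 0 := by
  have h0 : weakNorm p.conjExponent (fun _ : ℕ => (0 : Y)) = 0 := by
    simpa using weakNorm_const_smul
      (one_le_conjExponent p) 0 (fun _ => (0 : Y))
  have := latticiallyNuclearNorm_sum_le hp ∅ (0 : ℕ → StrongDual ℝ E)
    (x := fun _ => (0 : Y)) (by simp [IsWeaklyPSummable, h0]) (fun _ => le_rfl)
  simpa [h0] using this

theorem lpSum_single_le (hp : 1 ≤ p) (c : ℝ≥0∞) : lpSum p (Pi.single 0 c : ℕ → ℝ≥0∞) ≤ c := by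
  refine (lpSum_le_tsum hp _).trans_eq ?_
  rw [tsum_eq_single 0 fun j hj => by simp [hj]]
  simp

theorem strongNorm_single_le {F : Type*} [NormedAddCommGroup F] (hp : 1 ≤ p) (v : F) :
    strongNorm p (Pi.single 0 v : ℕ → F) ≤ ‖v‖ₑ := by
  refine le_trans (le_of_eq ?_) (lpSum_single_le hp ‖v‖ₑ)
  rw [strongNorm_eq_lpSum]
  congr 1
  ext j
  rcases eq_or_ne j 0 with rfl | hj <;> simp [*]

theorem latticiallyNuclearNorm_tensorOp_le (hp : 1 ≤ p) (v : StrongDual ℝ E) {y : Y}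
    (hy : 0 ≤ y) : latticiallyNuclearNorm p (tensorOp v y) ≤ ‖v‖ₑ * ‖y‖ₑ := by
  have hq : 1 ≤ p.conjExponent := one_le_conjExponent p
  have hw : weakNorm p.conjExponent (Pi.single 0 y : ℕ → Y) ≤ ‖y‖ₑ :=
    (weakNorm_le_strongNorm _).trans (strongNorm_single_le hq y)
  have h := latticiallyNuclearNorm_sum_le hp {0} (Pi.single 0 v) (hw.trans_lt enorm_lt_top)
    (fun j => by rcases eq_or_ne j 0 with rfl | hj <;> simp [*])
  simp only [Finset.sum_singleton, Pi.single_eq_same] at h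
  exact h.trans (mul_le_mul' (strongNorm_single_le hp v) hw)

theorem IsLatticiallyNuclearRep.sub_sum {S : E →L[ℝ] Y}
    {u : ℕ → StrongDual ℝ E} {x : ℕ → Y} (h : IsLatticiallyNuclearRep p S u x) (N : ℕ) :
    IsLatticiallyNuclearRep p (S - ∑ j ∈ Finset.range N, tensorOp (u j) (x j))
      ((Set.Ici N).indicator u) x where
  summable_left := h.summable_left.indicator _
  summable_right := h.summable_right
  nonneg := h.nonneg
  hasSum := by
    simp_rw [tensorOp_indicator]
    have h2 : HasSum ((Finset.range N : Set ℕ).indicator fun j => tensorOp (u j) (x j))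
        (∑ j ∈ Finset.range N, tensorOp (u j) (x j)) :=
      (hasSum_subtype_iff_indicator).1 (Finset.hasSum _ _)
    have h3 : ((Set.Ici N).indicator fun j => tensorOp (u j) (x j)) = fun j =>
        tensorOp (u j) (x j)
          - (Finset.range N : Set ℕ).indicator (fun j => tensorOp (u j) (x j)) j := by
      funext j
      by_cases hj : N ≤ j
      · simp [hj]
      · simp [hj, not_le.1 hj]
    exact h3 ▸ h.hasSum.sub h2

/-- The series converges in the nuclear norm itself, not only in operator norm; functionals
continuous for the nuclear norm can thus be evaluated term by term. -/
theorem IsLatticiallyNuclearRep.tendsto_tail (hp : 1 ≤ p) {S : E →L[ℝ] Y}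
    {u : ℕ → StrongDual ℝ E} {x : ℕ → Y} (h : IsLatticiallyNuclearRep p S u x) :
    ∀ ε : ℝ≥0∞, 0 < ε → ∃ N, ∀ n ≥ N, latticiallyNuclearNorm p
      (S - ∑ j ∈ Finset.range n, tensorOp (u j) (x j)) < ε := by
  intro ε hε
  rcases eq_or_ne ε ∞ with rfl | hεt
  · exact ⟨0, fun n _ => (latticiallyNuclearNorm_le (h.sub_sum n)).trans_lt
      (ENNReal.mul_lt_top (h.summable_left.indicator _).1 h.summable_right)⟩
  set W := weakNorm p.conjExponent x + 1 with hW
  have hWt : W ≠ ∞ := by simpa [hW] using h.summable_right.ne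
  have hW0 : W ≠ 0 := by simp [hW]
  obtain ⟨N, hN⟩ := h.summable_left.exists_tail_lt hp (ENNReal.div_pos hε.ne' hWt)
  refine ⟨N, fun n hn => (latticiallyNuclearNorm_le (h.sub_sum n)).trans_lt ?_⟩
  calc strongNorm p ((Set.Ici n).indicator u) * weakNorm p.conjExponent x
      ≤ strongNorm p ((Set.Ici N).indicator u) * W := by
        gcongr
        · refine strongNorm_mono fun j => norm_indicator_le_of_subset (Set.Ici_subset_Ici.2 hn) _ _
        · exact le_self_add
    _ < ε / W * W := ENNReal.mul_lt_mul_left hW0 hWt hN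
    _ = ε := ENNReal.div_mul_cancel hW0 hWt

theorem exists_rep_of_norm_lt [PosSMulMono ℝ Y] (hp : 1 ≤ p) {S : E →L[ℝ] Y} {α β : ℝ}
    (hα : 0 < α) (hβ : 0 < β) (h : latticiallyNuclearNorm p S < ENNReal.ofReal (α * β)) :
    ∃ u x, IsLatticiallyNuclearRep p S u x ∧ strongNorm p u ≤ ENNReal.ofReal α ∧
      weakNorm p.conjExponent x ≤ ENNReal.ofReal β := by
  obtain ⟨u, h⟩ := iInf_lt_iff.1 h
  obtain ⟨x, h⟩ := iInf_lt_iff.1 h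
  obtain ⟨hr, h⟩ := iInf_lt_iff.1 h
  have hA := hr.summable_left.1.ne
  have hW : weakNorm p.conjExponent x ≠ ∞ := hr.summable_right.ne
  set A := (strongNorm p u).toReal with hA'
  set W := (weakNorm p.conjExponent x).toReal with hW'
  have hA0 : 0 ≤ A := ENNReal.toReal_nonneg
  have hW0 : 0 ≤ W := ENNReal.toReal_nonneg
  have hlt : A * W < α * β := by
    rwa [← ENNReal.ofReal_toReal hA, ← ENNReal.ofReal_toReal hW, ← ENNReal.ofReal_mul hA0,
      ENNReal.ofReal_lt_ofReal_iff (by positivity)] at h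
  obtain ⟨c, hc, h1, h2⟩ : ∃ c : ℝ, 0 < c ∧ c * A ≤ α ∧ c⁻¹ * W ≤ β := by
    -- If `A = 0`, only the second bound restricts `c`, and the `+ 1` keeps `c` positive when `W =
    -- 0`. Otherwise `c` makes the first bound an equality and `A * W < α * β` gives the second.
    rcases hA0.eq_or_lt with hA0 | hA0
    · refine ⟨(W + 1) / β, by positivity, by simp [← hA0, hα.le], ?_⟩
      rw [inv_div, div_mul_eq_mul_div, div_le_iff₀ (by positivity)]
      nlinarith
    · refine ⟨α / A, by positivity, by field_simp; exact le_rfl, ?_⟩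
      rw [inv_div, div_mul_eq_mul_div, div_le_iff₀ (by positivity)]
      linarith
  refine ⟨_, _, hr.rescale hp hc, ?_, ?_⟩
  · rw [strongNorm_const_smul hp, ← ENNReal.ofReal_toReal hA, Real.enorm_of_nonneg hc.le,
      ← ENNReal.ofReal_mul hc.le]
    exact ENNReal.ofReal_le_ofReal h1
  · rw [weakNorm_const_smul (one_le_conjExponent p),
      ← ENNReal.ofReal_toReal hW, Real.enorm_of_nonneg (by positivity),
      ← ENNReal.ofReal_mul (by positivity)]
    exact ENNReal.ofReal_le_ofReal h2

/-- Countably many representations can be joined to a representation of the sum. -/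
theorem exists_rep_of_hasSum [CompleteSpace Y] (hp : 1 ≤ p) {ι : Type*} [Countable ι] [Nonempty ι]
    {s : ι → E →L[ℝ] Y} {S : E →L[ℝ] Y} (hS : HasSum s S)
    {u : ι → ℕ → StrongDual ℝ E} {x : ι → ℕ → Y}
    (h : ∀ k, IsLatticiallyNuclearRep p (s k) (u k) (x k)) {α β : ι → ℝ≥0∞}
    (hu : ∀ k, strongNorm p (u k) ≤ α k) (hx : ∀ k, weakNorm p.conjExponent (x k) ≤ β k)
    (hα : lpSum p α < ∞) (hα0 : p = ∞ → Filter.Tendsto α Filter.cofinite (nhds 0))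
    (hβ : lpSum p.conjExponent β < ∞) :
    ∃ u' x', IsLatticiallyNuclearRep p S u' x' ∧ strongNorm p u' ≤ lpSum p α ∧
      weakNorm p.conjExponent x' ≤ lpSum p.conjExponent β := by
  have hpq : p.HolderConjugate p.conjExponent := .conjExponent hp
  have hq : 1 ≤ p.conjExponent := one_le_conjExponent p
  obtain ⟨e⟩ : Nonempty (ℕ ≃ ι × ℕ) :=
    ⟨(nonempty_denumerable (ι × ℕ)).some.eqv.symm⟩
  have h1 : strongNorm p (fun n => u (e n).1 (e n).2) ≤ lpSum p α := by
    rw [strongNorm_eq_lpSum, lpSum_equiv e (fun n => ‖u n.1 n.2‖ₑ), lpSum_prod hp]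
    exact lpSum_mono hu
  have h2 : weakNorm p.conjExponent (fun n => x (e n).1 (e n).2)
      ≤ lpSum p.conjExponent β := by
    refine weakNorm_le fun f hf => ?_
    rw [lpSum_equiv e (fun n => ‖f (x n.1 n.2)‖ₑ), lpSum_prod hq]
    exact lpSum_mono fun k => (le_weakNorm (x k) hf).trans (hx k)
  have h3 : IsPSummable p (fun n => u (e n).1 (e n).2) := by
    refine ⟨h1.trans_lt hα, fun hpt => ?_⟩
    rw [← Nat.cofinite_eq_atTop]
    refine Filter.Tendsto.comp (g := fun n : ι × ℕ => u n.1 n.2) ?_ e.injective.tendsto_cofinite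
    rw [Metric.tendsto_nhds]
    intro ε hε
    -- Only finitely many blocks can contain a term of norm at least `ε`, and each of them is itself
    -- a null sequence.
    have hfin : {k | ¬ α k < ENNReal.ofReal ε}.Finite :=
      (hα0 hpt).eventually (gt_mem_nhds (ENNReal.ofReal_pos.2 hε))
    have hfin2 : ∀ k, {i | ¬ dist (u k i) 0 < ε}.Finite := fun k => by
      have := Metric.tendsto_nhds.1 ((h k).summable_left.2 hpt) ε hε
      rwa [← Nat.cofinite_eq_atTop] at this
    refine Set.Finite.subset (hfin.biUnion fun k _ => (hfin2 k).image (Prod.mk k)) ?_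
    rintro ⟨k, i⟩ hki
    simp only [Set.mem_iUnion, Set.mem_image]
    refine ⟨k, ?_, i, hki, rfl⟩
    intro hk
    apply hki
    have : ‖u k i‖ₑ < ENNReal.ofReal ε :=
      ((le_lpSum hp (fun j => ‖u k j‖ₑ) i).trans (hu k)).trans_lt hk
    rw [← ofReal_norm, ENNReal.ofReal_lt_ofReal_iff hε] at this
    simpa using this
  have h4 : IsWeaklyPSummable p.conjExponent (fun n => x (e n).1 (e n).2) := h2.trans_lt hβ
  refine ⟨_, _, ⟨h3, h4, fun j => (h _).nonneg _, ?_⟩, h1, h2⟩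
  -- Unconditional convergence permits summing block by block, which identifies the joined sum with
  -- `S`.
  obtain ⟨T, hT⟩ := summable_tensorOp hpq h3 h4
  have hT' : HasSum (fun n : ι × ℕ => tensorOp (u n.1 n.2) (x n.1 n.2)) T :=
    (e.hasSum_iff (f := fun n : ι × ℕ => tensorOp (u n.1 n.2) (x n.1 n.2))).1 hT
  rwa [hS.unique (hT'.prod_fiberwise fun k => (h k).hasSum)]

/-- A cost `t` is balanced as `t ^ (1/p)` for the strong factor and `t ^ (1/p*)` for the weak one,
that is `(1, t)` for `p = ∞` and `(t, 1)` for `p = 1`. The joined factors then have norms at most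
the weights of `a + b`, whose product is `a + b`. -/
theorem latticiallyNuclearNorm_add_le [CompleteSpace Y] [PosSMulMono ℝ Y] (hp : 1 ≤ p)
    (S T : E →L[ℝ] Y) : latticiallyNuclearNorm p (S + T) ≤
      latticiallyNuclearNorm p S + latticiallyNuclearNorm p T := by
  have hpq : p.HolderConjugate p.conjExponent := .conjExponent hp
  have hq : 1 ≤ p.conjExponent := one_le_conjExponent p
  suffices key : ∀ a b : ℝ, 0 < a → 0 < b → latticiallyNuclearNorm p S < ENNReal.ofReal a →
      latticiallyNuclearNorm p T < ENNReal.ofReal b →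
      latticiallyNuclearNorm p (S + T) ≤ ENNReal.ofReal (a + b) by
    rcases eq_or_ne (latticiallyNuclearNorm p S) ∞ with h | hS
    · simp [h]
    rcases eq_or_ne (latticiallyNuclearNorm p T) ∞ with h | hT
    · simp [h]
    set A := (latticiallyNuclearNorm p S).toReal with hA
    set B := (latticiallyNuclearNorm p T).toReal with hB
    have hA0 : 0 ≤ A := ENNReal.toReal_nonneg
    have hB0 : 0 ≤ B := ENNReal.toReal_nonneg
    rw [← ENNReal.ofReal_toReal hS, ← ENNReal.ofReal_toReal hT, ← ENNReal.ofReal_add hA0 hB0]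
    refine ENNReal.le_of_forall_pos_le_add fun ε hε _ => ?_
    have hε' : (0 : ℝ) < ε := hε
    refine (key (A + ε / 2) (B + ε / 2) (by positivity) (by positivity) ?_ ?_).trans_eq ?_
    · rw [← ENNReal.ofReal_toReal hS, ENNReal.ofReal_lt_ofReal_iff (by positivity)]
      linarith
    · rw [← ENNReal.ofReal_toReal hT, ENNReal.ofReal_lt_ofReal_iff (by positivity)]
      linarith
    · rw [← ENNReal.ofReal_coe_nnreal, ← ENNReal.ofReal_add (by positivity) (by positivity)]
      congr 1
      ring
  intro a b ha hb hSa hTb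
  -- the Hölder weights
  obtain ⟨w, hw0, hwα, hwβ⟩ : ∃ w : ℝ → ℝ × ℝ, (∀ t > 0, 0 < (w t).1 ∧ 0 < (w t).2 ∧
      (w t).1 * (w t).2 = t) ∧
      (lpSum p (fun k : Bool => ENNReal.ofReal (w (bif k then a else b)).1)
        ≤ ENNReal.ofReal (w (a + b)).1) ∧
      (lpSum p.conjExponent (fun k : Bool => ENNReal.ofReal (w (bif k then a else b)).2)
        ≤ ENNReal.ofReal (w (a + b)).2) := by
    by_cases hpt : p = ∞
    · have hq1 : p.conjExponent = 1 := (ENNReal.HolderConjugate.eq_top_iff_eq_one p _).1 hpt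
      refine ⟨fun t => (1, t), fun t ht => ⟨one_pos, ht, one_mul t⟩, ?_, ?_⟩
      · subst hpt
        simp [lpSum_top]
      · refine (lpSum_le_tsum hq _).trans_eq ?_
        rw [tsum_bool]
        simp [ENNReal.ofReal_add ha.le hb.le, add_comm]
    by_cases hqt : p.conjExponent = ∞
    · have hp1 : p = 1 := (ENNReal.HolderConjugate.eq_top_iff_eq_one _ p).1 hqt
      refine ⟨fun t => (t, 1), fun t ht => ⟨ht, one_pos, mul_one t⟩, ?_, ?_⟩
      · refine (lpSum_le_tsum hp _).trans_eq ?_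
        rw [tsum_bool]
        simp [ENNReal.ofReal_add ha.le hb.le, add_comm]
      · rw [hqt]
        simp [lpSum_top]
    have hr := toReal_holderConjugate hpq hpt hqt
    have hw : ∀ r : ℝ≥0∞, 1 ≤ r → r ≠ ∞ →
        lpSum r (fun k : Bool => ENNReal.ofReal ((bif k then a else b) ^ (1 / r.toReal)))
          ≤ ENNReal.ofReal ((a + b) ^ (1 / r.toReal)) := by
      intro r hr1 hrt
      have := one_le_toReal hr1 hrt
      have key : ∀ t : ℝ, 0 < t → ENNReal.ofReal (t ^ (1 / r.toReal)) ^ r.toReal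
          = ENNReal.ofReal t := fun t ht => by
        rw [ENNReal.ofReal_rpow_of_nonneg (by positivity) (by positivity), ← Real.rpow_mul ht.le,
          one_div_mul_cancel (by positivity), Real.rpow_one]
      rw [lpSum_le_iff hr1 hrt, tsum_bool, key (a + b) (by positivity)]
      simp only [cond_true, cond_false]
      rw [key _ ha, key _ hb, ENNReal.ofReal_add ha.le hb.le, add_comm]
    refine ⟨fun t => (t ^ (1 / p.toReal), t ^ (1 / p.conjExponent.toReal)), fun t ht =>
      ⟨by positivity, by positivity, ?_⟩, hw p hp hpt, hw _ hq hqt⟩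
    rw [← Real.rpow_add ht, one_div, one_div, hr.inv_add_inv_eq_one, Real.rpow_one]
  have hrep : ∀ k : Bool, ∃ u x, IsLatticiallyNuclearRep p (bif k then S else T) u x ∧
      strongNorm p u ≤ ENNReal.ofReal (w (bif k then a else b)).1 ∧
      weakNorm p.conjExponent x ≤ ENNReal.ofReal (w (bif k then a else b)).2 := by
    intro k
    cases k
    · exact exists_rep_of_norm_lt hp (hw0 b hb).1 (hw0 b hb).2.1 (by
        change _ < ENNReal.ofReal ((w b).1 * (w b).2)
        rw [(hw0 b hb).2.2]
        exact hTb)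
    · exact exists_rep_of_norm_lt hp (hw0 a ha).1 (hw0 a ha).2.1 (by
        change _ < ENNReal.ofReal ((w a).1 * (w a).2)
        rw [(hw0 a ha).2.2]
        exact hSa)
  choose u x hr hu hx using hrep
  have hsum : HasSum (fun k : Bool => bif k then S else T) (S + T) := by
    convert hasSum_fintype (fun k : Bool => bif k then S else T) using 1
    simp
  obtain ⟨u', x', h1, h2, h3⟩ := exists_rep_of_hasSum hp hsum hr hu hx
    (hwα.trans_lt ENNReal.ofReal_lt_top) (fun _ => by simp [Filter.cofinite_eq_bot])
    (hwβ.trans_lt ENNReal.ofReal_lt_top)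
  refine (latticiallyNuclearNorm_le h1).trans ?_
  have hab := hw0 (a + b) (by positivity)
  rw [← hab.2.2, ENNReal.ofReal_mul hab.1.le]
  exact mul_le_mul' (h2.trans hwα) (h3.trans hwβ)

end NuclearNorm

/-! ### Hahn-Banach on cones and positive majorants of functionals -/

section HahnBanach

/-- A linear functional dominated on a convex cone `K` by the seminorm `C * ‖L y‖` is dominated
on `K` by `D ∘ L` for some functional `D` of norm at most `C`. -/
theorem exists_dual_ge_on_cone {V W : Type*} [AddCommGroup V] [Module ℝ V]
    [NormedAddCommGroup W] [NormedSpace ℝ W] {K : Set V} (h0 : (0 : V) ∈ K)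
    (hadd : ∀ x ∈ K, ∀ y ∈ K, x + y ∈ K) (hsmul : ∀ c : ℝ, 0 < c → ∀ x ∈ K, c • x ∈ K)
    (L : V →ₗ[ℝ] W) (g : V →ₗ[ℝ] ℝ) {C : ℝ} (hC : 0 ≤ C) (h : ∀ y ∈ K, g y ≤ C * ‖L y‖) :
    ∃ D : StrongDual ℝ W, ‖D‖ ≤ C ∧ ∀ y ∈ K, g y ≤ D (L y) := by
  have : Nonempty K := ⟨⟨0, h0⟩⟩
  -- `P` is sublinear, `P w ≤ C * ‖w‖` (take `y = 0`) and `P (-L y) ≤ -g y`. Any linear functional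
  -- below `P` therefore has both required properties.
  set P : W → ℝ := fun w => ⨅ y : K, (C * ‖w + L y‖ - g y) with hP
  have hbdd : ∀ w, BddBelow (Set.range fun y : K => C * ‖w + L y‖ - g y) := fun w => by
    refine ⟨-(C * ‖w‖), ?_⟩
    rintro _ ⟨⟨y, hy⟩, rfl⟩
    have h1 : ‖L y‖ ≤ ‖w + L y‖ + ‖w‖ := by
      calc ‖L y‖ = ‖(w + L y) - w‖ := by rw [add_sub_cancel_left]
        _ ≤ _ := norm_sub_le _ _
    have h2 := mul_le_mul_of_nonneg_left h1 hC
    have h3 := h y hy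
    simp only
    linarith
  have hPle : ∀ w, ∀ y ∈ K, P w ≤ C * ‖w + L y‖ - g y := fun w y hy =>
    ciInf_le (hbdd w) (⟨y, hy⟩ : K)
  have hsm : ∀ c : ℝ, 0 < c → ∀ w, P (c • w) ≤ c * P w := by
    intro c hc w
    rw [hP, Real.mul_iInf_of_nonneg hc.le]
    refine le_ciInf fun ⟨y, hy⟩ => (hPle _ _ (hsmul c hc y hy)).trans_eq ?_
    rw [map_smul, map_smul, ← smul_add, norm_smul, Real.norm_of_nonneg hc.le, smul_eq_mul]
    ring
  obtain ⟨D, -, hD⟩ := exists_extension_of_le_sublinear (⟨⊥, 0⟩ : W →ₗ.[ℝ] ℝ) P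
    (fun c hc w => (hsm c hc w).antisymm (by
      have := hsm c⁻¹ (inv_pos.2 hc) (c • w)
      rw [inv_smul_smul₀ hc.ne'] at this
      calc c * P w ≤ c * (c⁻¹ * P (c • w)) := by gcongr
        _ = P (c • w) := by rw [mul_inv_cancel_left₀ hc.ne']))
    (fun w w' => le_ciInf_add_ciInf fun ⟨y, hy⟩ ⟨y', hy'⟩ => by
      refine (hPle _ _ (hadd y hy y' hy')).trans ?_
      have : ‖w + w' + L (y + y')‖ ≤ ‖w + L y‖ + ‖w' + L y'‖ := by
        rw [map_add, add_add_add_comm]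
        exact norm_add_le _ _
      have := mul_le_mul_of_nonneg_left this hC
      have hg := map_add g y y'
      simp only at *
      linarith)
    (fun ⟨w, hw⟩ => by
      obtain rfl : w = 0 := by simpa using hw
      refine le_ciInf fun ⟨y, hy⟩ => ?_
      have := h y hy
      simp only [zero_add]
      simpa using this)
  have hDle : ∀ w, D w ≤ C * ‖w‖ := fun w => by
    simpa using (hD w).trans (hPle w 0 h0)
  refine ⟨D.mkContinuous C fun w => abs_le.2 ⟨?_, hDle w⟩, D.mkContinuous_norm_le hC _, ?_⟩
  · have := hDle (-w)
    rw [map_neg, norm_neg] at this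
    linarith
  · intro y hy
    have := (hD (-L y)).trans (hPle (-L y) y hy)
    simp only [map_neg, neg_add_cancel, norm_zero, mul_zero, zero_sub] at this
    exact le_of_neg_le_neg this

/-- A linear functional dominated by a sublinear functional, and equal to it at a given point. -/
theorem exists_linear_le_sublinear {V : Type*} [AddCommGroup V] [Module ℝ V] (P : V → ℝ)
    (hsm : ∀ c : ℝ, 0 < c → ∀ x, P (c • x) ≤ c * P x) (hadd : ∀ x y, P (x + y) ≤ P x + P y)
    (hnn : ∀ x, 0 ≤ P x) (z : V) : ∃ f : V →ₗ[ℝ] ℝ, f z = P z ∧ ∀ x, f x ≤ P x := by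
  have hsm' : ∀ c : ℝ, 0 < c → ∀ x, P (c • x) = c * P x := fun c hc x =>
    (hsm c hc x).antisymm (by
      have := hsm c⁻¹ (inv_pos.2 hc) (c • x)
      rw [inv_smul_smul₀ hc.ne'] at this
      calc c * P x ≤ c * (c⁻¹ * P (c • x)) := by gcongr
        _ = P (c • x) := by rw [mul_inv_cancel_left₀ hc.ne'])
  have hP0 : P 0 = 0 := by
    have := hsm' 2 two_pos 0
    rw [smul_zero] at this
    linarith
  rcases eq_or_ne z 0 with rfl | hz
  · exact ⟨0, by simp [hP0], fun x => by simpa using hnn x⟩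
  -- The functional `c • z ↦ c * P z` on the line through `z` is below `P`: for `c ≤ 0` its value is
  -- nonpositive while `P` is nonnegative.
  obtain ⟨f, hf, hle⟩ := exists_extension_of_le_sublinear
    (LinearPMap.mkSpanSingleton z (P z) hz) P hsm' hadd (by
      rintro ⟨x, hx⟩
      obtain ⟨c, rfl⟩ := Submodule.mem_span_singleton.1 hx
      rw [show LinearPMap.mkSpanSingleton z (P z) hz ⟨c • z, hx⟩ = c * P z from
        LinearPMap.mkSpanSingleton'_apply _ _ _ _ _]
      rcases le_or_gt c 0 with hc | hc
      · exact (mul_nonpos_of_nonpos_of_nonneg hc (hnn z)).trans (hnn _)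
      · exact (hsm' c hc z).ge)
  refine ⟨f, ?_, hle⟩
  have := hf ⟨z, Submodule.mem_span_singleton_self z⟩
  rw [this]
  exact LinearPMap.mkSpanSingleton_apply ℝ ℝ hz (P z)

variable {Y : Type*} [NormedAddCommGroup Y] [NormedSpace ℝ Y] [Preorder Y]
  [IsOrderedAddMonoid Y] [PosSMulMono ℝ Y]

/-- On pairs of positive vectors, `(a, b) ↦ φ a` is dominated by `‖φ‖ * ‖a + b‖`. A dominating
functional of `a + b` majorizes `φ` on pairs `(y, 0)` and `0` on pairs `(0, y)`. This stands in for
the positive part of `φ` without any lattice operations in the dual. -/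
theorem exists_nonneg_ge_of_norm_mono (hY : ∀ a b : Y, 0 ≤ a → 0 ≤ b → ‖a‖ ≤ ‖a + b‖)
    (φ : StrongDual ℝ Y) : ∃ ψ : StrongDual ℝ Y, 0 ≤ ψ ∧ φ ≤ ψ ∧ ‖ψ‖ ≤ ‖φ‖ := by
  obtain ⟨D, hD, hDle⟩ := exists_dual_ge_on_cone (K := {z : Y × Y | 0 ≤ z.1 ∧ 0 ≤ z.2})
    ⟨le_rfl, le_rfl⟩ (fun x hx y hy => ⟨add_nonneg hx.1 hy.1, add_nonneg hx.2 hy.2⟩)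
    (fun c hc x hx => ⟨smul_nonneg hc.le hx.1, smul_nonneg hc.le hx.2⟩)
    (LinearMap.fst ℝ Y Y + LinearMap.snd ℝ Y Y)
    ((φ : Y →ₗ[ℝ] ℝ) ∘ₗ LinearMap.fst ℝ Y Y) (norm_nonneg φ) (fun y hy => by
      refine (le_abs_self _).trans ((φ.le_opNorm _).trans ?_)
      exact mul_le_mul_of_nonneg_left (hY _ _ hy.1 hy.2) (norm_nonneg _))
  refine ⟨D, fun y hy => ?_, fun y hy => ?_, hD⟩
  · simpa using hDle (0, y) ⟨le_rfl, hy⟩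
  · simpa using hDle (y, 0) ⟨hy, le_rfl⟩

theorem dual_norm_mono {X : Type*} [NormedAddCommGroup X] [NormedSpace ℝ X] [Lattice X]
    [IsOrderedAddMonoid X] [HasSolidNorm X] (f g : StrongDual ℝ X) (hf : 0 ≤ f) (hg : 0 ≤ g) :
    ‖f‖ ≤ ‖f + g‖ := by
  refine f.opNorm_le_bound (norm_nonneg _) fun x => ?_
  have h1 : |f x| ≤ f |x| := by
    rw [abs_le]
    constructor
    · have := hf (|x| + x) (by
        have := neg_le_abs x
        rw [← sub_nonneg] at this
        simpa using this)
      simp only [map_add, zero_apply] at this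
      linarith
    · have := hf (|x| - x) (sub_nonneg.2 (le_abs_self x))
      simp only [map_sub, zero_apply] at this
      linarith
  calc ‖f x‖ ≤ f |x| := h1
    _ ≤ (f + g) |x| := by
        have : 0 ≤ g |x| := hg _ (abs_nonneg x)
        simpa using this
    _ ≤ ‖f + g‖ * ‖|x|‖ := (le_abs_self _).trans ((f + g).le_opNorm _)
    _ = ‖f + g‖ * ‖x‖ := by rw [norm_abs_eq_norm]

end HahnBanach

/-! ### The dual of a finite sup-norm power -/

section Pi

/-- Almost norming unit-ball vectors, one for each coordinate, together form a single vector of sup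
norm at most `1`. -/
theorem sum_norm_comp_single_le {ι Y : Type*} [Fintype ι] [DecidableEq ι] [NormedAddCommGroup Y]
    [NormedSpace ℝ Y] (D : StrongDual ℝ (ι → Y)) :
    ∑ i, ‖D.comp (ContinuousLinearMap.single ℝ (fun _ : ι => Y) i)‖ ≤ ‖D‖ := by
  refine le_of_forall_pos_le_add fun ε hε => ?_
  set f : ι → StrongDual ℝ Y := fun i => D.comp (ContinuousLinearMap.single ℝ (fun _ : ι => Y) i)
  set η := ε / (Fintype.card ι + 1)
  have hη : 0 < η := by positivity
  have h1 : ∀ i, ∃ y : Y, ‖y‖ ≤ 1 ∧ ‖f i‖ - η ≤ f i y := fun i => by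
    obtain ⟨y, hy, hfy⟩ := (f i).exists_lt_apply_of_lt_opNorm (sub_lt_self ‖f i‖ hη)
    rcases abs_cases (f i y) with h | h
    · exact ⟨y, hy.le, hfy.le.trans h.1.le⟩
    · exact ⟨-y, by simpa using hy.le, by rw [map_neg]; exact hfy.le.trans h.1.le⟩
  choose y hy hfy using h1
  have h2 : D y = ∑ i, f i (y i) := by
    simp only [f, ContinuousLinearMap.comp_apply, ← map_sum]
    congr 1
    simp [Finset.univ_sum_single]
  have h3 : D y ≤ ‖D‖ := (le_abs_self _).trans
    (D.unit_le_opNorm y ((pi_norm_le_iff_of_nonneg zero_le_one).2 hy))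
  have h4 : ∑ i, (‖f i‖ - η) ≤ D y := h2 ▸ Finset.sum_le_sum fun i _ => hfy i
  rw [Finset.sum_sub_distrib, Finset.sum_const, Finset.card_univ, nsmul_eq_mul] at h4
  have h5 : (Fintype.card ι : ℝ) * η ≤ ε := by
    rw [mul_div_assoc', div_le_iff₀ (by positivity)]
    nlinarith
  linarith

end Pi

/-! ### Bounded forms and their extension to the bidual -/

section LocalReflexivity

variable {F Y : Type*} [NormedAddCommGroup F] [NormedSpace ℝ F]
  [NormedAddCommGroup Y] [NormedSpace ℝ Y] {p : ℝ≥0∞}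

/-- The weak norm on `s` is the supremum of `‖∑ a j • y j‖` over the unit ball of `ℓ_p` on `s`,
which is totally bounded; `A` is a finite net in it, chosen before `y`. -/
theorem exists_finite_weakNorm_norming {q : ℝ≥0∞} (hpq : p.HolderConjugate q) (s : Finset ℕ)
    {ε : ℝ} (hε : 0 < ε) : ∃ A : Finset (ℕ → ℝ),
      (∀ a ∈ A, lpSum p (fun j => ‖a j‖ₑ) ≤ 1) ∧
      ∀ (y : ℕ → Y) (c : ℝ), (∀ a ∈ A, ‖∑ j ∈ s, a j • y j‖ ≤ c) →
        weakNorm q ((s : Set ℕ).indicator y) ≤ ENNReal.ofReal ((1 + ε) * c) := by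
  classical
  have hp : 1 ≤ p := ENNReal.HolderConjugate.one_le p q
  have hq : 1 ≤ q := ENNReal.HolderConjugate.one_le q p
  set ext : (s → ℝ) → ℕ → ℝ := fun a j => if h : j ∈ s then a ⟨j, h⟩ else 0 with hext
  set T : Set (s → ℝ) := {a | lpSum p (fun j => ‖ext a j‖ₑ) ≤ 1} with hT
  have hTb : TotallyBounded T := by
    refine (isCompact_closedBall (0 : s → ℝ) 1).totallyBounded.subset fun a ha => ?_
    rw [mem_closedBall_zero_iff, pi_norm_le_iff_of_nonneg zero_le_one]
    rintro ⟨j, hj⟩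
    have := (le_lpSum hp (fun j => ‖ext a j‖ₑ) j).trans ha
    simp only [hext, hj, dif_pos] at this
    rw [← ofReal_norm, ENNReal.ofReal_le_one] at this
    exact this
  -- The net will give `w ≤ c + δ * w` for the weak norm `w`; since `1 - δ = 1 / (1 + ε)`, this is
  -- `w ≤ (1 + ε) * c`.
  set δ := ε / (1 + ε) with hδ
  have hδ0 : 0 < δ := by positivity
  set η := δ / (s.card + 1) with hη
  have hη0 : 0 < η := by positivity
  obtain ⟨t, htT, htf, hcov⟩ := Metric.finite_approx_of_totallyBounded hTb η hη0
  refine ⟨htf.toFinset.image ext, fun a ha => ?_, fun y c hc => ?_⟩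
  · obtain ⟨b, hb, rfl⟩ := Finset.mem_image.1 ha
    exact htT (htf.mem_toFinset.1 hb)
  have hwt : weakNorm q ((s : Set ℕ).indicator y) ≠ ∞ :=
    ((weakNorm_le_strongNorm _).trans_lt (isPSummable_indicator hq s y).1).ne
  set w := (weakNorm q ((s : Set ℕ).indicator y)).toReal with hw
  have hw0 : 0 ≤ w := ENNReal.toReal_nonneg
  have hyw : ∀ j ∈ s, ‖y j‖ ≤ w := fun j hj => by
    have := enorm_le_weakNorm hq ((s : Set ℕ).indicator y) j
    rw [Set.indicator_of_mem (by simpa using hj), ← ENNReal.ofReal_toReal hwt, ← ofReal_norm,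
      ENNReal.ofReal_le_ofReal_iff hw0] at this
    exact this
  have hc' : ∀ a : ℕ → ℝ, lpSum p (fun j => ‖a j‖ₑ) ≤ 1 → (∀ j ∉ s, a j = 0) →
      ‖∑ j ∈ s, a j • y j‖ ≤ c + δ * w := by
    intro a ha ha0
    have hae : ext (fun j => a j) = a := by
      funext j
      by_cases hj : j ∈ s
      · simp [hext, hj]
      · simp [hext, hj, ha0 j hj]
    have haT : (fun j : s => a j) ∈ T := by
      change lpSum p (fun j => ‖ext (fun j => a j) j‖ₑ) ≤ 1
      rwa [hae]
    obtain ⟨b, hb, hab⟩ := Set.mem_iUnion₂.1 (hcov haT)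
    have hab' : ∀ j ∈ s, |a j - ext b j| ≤ η := fun j hj => by
      have := (dist_le_pi_dist (fun j : s => a j) b ⟨j, hj⟩).trans (Metric.mem_ball.1 hab).le
      simpa [hext, hj, Real.dist_eq] using this
    have h1 : ∑ j ∈ s, a j • y j = ∑ j ∈ s, ext b j • y j + ∑ j ∈ s, (a j - ext b j) • y j := by
      rw [← Finset.sum_add_distrib]
      refine Finset.sum_congr rfl fun j _ => ?_
      rw [← add_smul, add_sub_cancel]
    have h2 : ‖∑ j ∈ s, (a j - ext b j) • y j‖ ≤ s.card * (η * w) := by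
      rw [← nsmul_eq_mul]
      refine norm_sum_le_of_le s (fun j hj => ?_) |>.trans_eq (by rw [Finset.sum_const])
      rw [norm_smul]
      exact mul_le_mul (hab' j hj) (hyw j hj) (norm_nonneg _) hη0.le
    have h3 : (s.card : ℝ) * (η * w) ≤ δ * w := by
      rw [← mul_assoc]
      refine mul_le_mul_of_nonneg_right ?_ hw0
      rw [hη, mul_div_assoc', div_le_iff₀ (by positivity)]
      nlinarith
    have h4 := hc (ext b) (Finset.mem_image_of_mem _ (htf.mem_toFinset.2 hb))
    rw [h1]
    exact (norm_add_le _ _).trans (by linarith)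
  have hle : weakNorm q ((s : Set ℕ).indicator y) ≤ ENNReal.ofReal (c + δ * w) := by
    refine weakNorm_le fun f hf => ?_
    obtain ⟨a, ha, ha0, hle⟩ := exists_dual_lpSum hpq s (fun j => f (y j))
    refine le_trans (le_of_eq ?_) (hle.trans (ENNReal.ofReal_le_ofReal ?_))
    · congr 1
      ext j
      by_cases hj : j ∈ s <;> simp [hj]
    · calc ∑ j ∈ s, a j * f (y j) = f (∑ j ∈ s, a j • y j) := by simp
        _ ≤ ‖∑ j ∈ s, a j • y j‖ := (le_abs_self _).trans
            ((f.le_of_opNorm_le hf _).trans (one_mul _).le)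
        _ ≤ _ := hc' a ha ha0
  have hc0 : 0 ≤ c + δ * w := by
    have := hc' 0 (by simpa using (lpSum_le_tsum hp _).trans (by simp)) (by simp)
    exact (norm_nonneg _).trans this
  rw [← ENNReal.ofReal_toReal hwt, ENNReal.ofReal_le_ofReal_iff hc0] at hle
  rw [← ENNReal.ofReal_toReal hwt]
  refine ENNReal.ofReal_le_ofReal ?_
  have h5 : (1 + ε) * δ = ε := by rw [hδ]; field_simp
  have h6 := mul_le_mul_of_nonneg_left hle (show 0 ≤ 1 + ε by positivity)
  rw [mul_add, ← mul_assoc (1 + ε) δ w, h5] at h6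
  change w ≤ _
  change (1 + ε) * w ≤ _ at h6
  linarith

variable [Preorder Y]

/-- The bilinear form `B` is bounded with respect to the latticially `p`-nuclear tensor norm. -/
def IsBoundedForm (p : ℝ≥0∞) (C : ℝ) (B : F →L[ℝ] StrongDual ℝ Y) : Prop :=
  ∀ (s : Finset ℕ) (v : ℕ → F) (y : ℕ → Y) (α β : ℝ), 0 ≤ α → 0 ≤ β →
    strongNorm p v ≤ ENNReal.ofReal α → weakNorm p.conjExponent y ≤ ENNReal.ofReal β →
    (∀ j, 0 ≤ y j) → ∑ j ∈ s, B (v j) (y j) ≤ C * α * β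

theorem IsBoundedForm.sub {C C' : ℝ} {B B' : F →L[ℝ] StrongDual ℝ Y} (hp : 1 ≤ p)
    (h : IsBoundedForm p C B) (h' : IsBoundedForm p C' B') :
    IsBoundedForm p (C + C') (B - B') := by
  intro s v y α β hα hβ hv hy hy0
  have h1 := h s v y α β hα hβ hv hy hy0
  have h2 := h' s (fun j => (-1 : ℝ) • v j) y α β hα hβ
    (by rw [strongNorm_const_smul hp]; simpa using hv) hy hy0
  simp only [neg_smul, one_smul, map_neg, neg_apply,
    Finset.sum_neg_distrib] at h2
  simp only [sub_apply, Finset.sum_sub_distrib]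
  linarith

/-- The canonical extension of a bounded form to the bidual is bounded with the same constant. -/
theorem IsBoundedForm.bidual [IsOrderedAddMonoid Y] [PosSMulMono ℝ Y] (hp : 1 ≤ p) {C : ℝ}
    (hC : 0 ≤ C) {B : F →L[ℝ] StrongDual ℝ Y} (h : IsBoundedForm p C B) :
    IsBoundedForm p C ((NormedSpace.inclusionInDoubleDual ℝ (StrongDual ℝ Y)) ∘L B) := by
  classical
  intro s v ψ α β hα hβ hv hψ hψ0
  have hpq : p.HolderConjugate p.conjExponent := .conjExponent hp
  suffices key : ∀ ε > 0, ∑ j ∈ s, ψ j (B (v j)) ≤ (1 + ε) * (C * α * β) by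
    have hlim : Filter.Tendsto (fun ε : ℝ => (1 + ε) * (C * α * β)) (nhdsWithin 0 (Set.Ioi 0))
        (nhds ((1 + 0) * (C * α * β))) :=
      (Continuous.tendsto (by fun_prop) 0).mono_left nhdsWithin_le_nhds
    have := ge_of_tendsto hlim (by filter_upwards [self_mem_nhdsWithin] with ε hε using key ε hε)
    simpa using this
  intro ε hε
  obtain ⟨A, hA, hAn⟩ := exists_finite_weakNorm_norming (Y := Y) hpq s hε
  let L : (ℕ → Y) →ₗ[ℝ] (A → Y) :=
    LinearMap.pi fun a => ∑ j ∈ s, (a : ℕ → ℝ) j • LinearMap.proj j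
  have hL : ∀ y a, L y a = ∑ j ∈ s, (a : ℕ → ℝ) j • y j := fun y a => by simp [L]
  let g : (ℕ → Y) →ₗ[ℝ] ℝ := ∑ j ∈ s, (B (v j) : Y →ₗ[ℝ] ℝ) ∘ₗ LinearMap.proj j
  have hg : ∀ y, g y = ∑ j ∈ s, B (v j) (y j) := fun y => by simp [g]
  -- On positive sequences the sup norm of `L y` controls the weak norm up to `1 + ε`, so
  -- boundedness of the form is domination by `‖L y‖`. The resulting `D` on the finite power of `Y`
  -- is a family `f a` whose norms add up to at most `(1 + ε) * (C * α)`.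
  obtain ⟨D, hD, hDle⟩ := exists_dual_ge_on_cone (K := {y : ℕ → Y | ∀ j, 0 ≤ y j})
    (fun _ => le_rfl) (fun x hx y hy j => add_nonneg (hx j) (hy j))
    (fun c hc x hx j => smul_nonneg hc.le (hx j)) L g (C := (1 + ε) * (C * α)) (by positivity)
    (fun y hy => by
      have hw := hAn y ‖L y‖ fun a ha => by
        rw [← hL y ⟨a, ha⟩]
        exact norm_le_pi_norm _ _
      have := h s v _ α ((1 + ε) * ‖L y‖) hα (by positivity) hv hw
        (fun j => by by_cases hj : j ∈ s <;> simp [hj, hy j])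
      rw [hg]
      refine le_trans (le_of_eq (Finset.sum_congr rfl fun j hj => ?_)) (this.trans_eq (by ring))
      rw [Set.indicator_of_mem (by simpa using hj)])
  set f : A → StrongDual ℝ Y := fun a =>
    D.comp (ContinuousLinearMap.single ℝ (fun _ : A => Y) a) with hf
  have hDf : ∀ w : A → Y, D w = ∑ a, f a (w a) := fun w => by
    simp only [hf, ContinuousLinearMap.comp_apply, ← map_sum]
    congr 1
    exact (Finset.univ_sum_single w).symm
  -- Testing the domination on sequences supported at one index turns it into an inequality in `Y*`,
  -- to which the positive functionals `ψ j` can be applied.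
  have hBle : ∀ j ∈ s, B (v j) ≤ ∑ a : A, (a : ℕ → ℝ) j • f a := fun j hj y hy => by
    have h1 := hDle (Pi.single j y) fun i => by
      rcases eq_or_ne i j with rfl | hij <;> simp [*]
    rw [hg, hDf] at h1
    rw [Finset.sum_eq_single_of_mem j hj fun i _ hij => by simp [hij]] at h1
    simp only [hL] at h1
    have h2 : ∀ a : A, ∑ i ∈ s, (a : ℕ → ℝ) i • (Pi.single j y : ℕ → Y) i = (a : ℕ → ℝ) j • y :=
      fun a => by
        rw [Finset.sum_eq_single_of_mem j hj fun i _ hij => by simp [hij], Pi.single_eq_same]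
    simpa [h2] using h1
  have hΨ : ∀ a : A, ‖∑ j ∈ s, (a : ℕ → ℝ) j • ψ j‖ ≤ β := fun a => by
    have := (enorm_sum_smul_le hpq s a ψ).trans (mul_le_mul' (hA a a.2) hψ)
    rw [one_mul, ← ofReal_norm, ENNReal.ofReal_le_ofReal_iff hβ] at this
    exact this
  calc ∑ j ∈ s, ψ j (B (v j)) ≤ ∑ j ∈ s, ψ j (∑ a : A, (a : ℕ → ℝ) j • f a) := by
        refine Finset.sum_le_sum fun j hj => ?_
        have := hψ0 j (_ - _) (sub_nonneg.2 (hBle j hj))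
        simpa using this
    _ = ∑ a : A, (∑ j ∈ s, (a : ℕ → ℝ) j • ψ j) (f a) := by
        simp only [map_sum, sum_apply, map_smul,
          smul_apply]
        exact Finset.sum_comm
    _ ≤ ∑ a : A, β * ‖f a‖ := Finset.sum_le_sum fun a _ => (le_abs_self _).trans
        (ContinuousLinearMap.le_of_opNorm_le _ (hΨ a) _)
    _ = β * ∑ a : A, ‖f a‖ := (Finset.mul_sum _ _ _).symm
    _ ≤ β * ((1 + ε) * (C * α)) := by
        gcongr
        exact (sum_norm_comp_single_le D).trans hD
    _ = (1 + ε) * (C * α * β) := by ring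

end LocalReflexivity

/-! ### The approximation property and traces of nuclear representations -/

section ApproximationProperty

theorem IsFiniteRank.exists_eq_sum {F G : Type*} [NormedAddCommGroup F] [NormedSpace ℝ F]
    [NormedAddCommGroup G] [NormedSpace ℝ G] {R : F →L[ℝ] G} (hR : IsFiniteRank R) :
    ∃ (n : ℕ) (f : Fin n → StrongDual ℝ F) (g : Fin n → G), ∀ x, R x = ∑ i, f i x • g i := by
  have : FiniteDimensional ℝ (LinearMap.range (R : F →ₗ[ℝ] G)) := hR
  let b := Module.finBasis ℝ (LinearMap.range (R : F →ₗ[ℝ] G))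
  let R' : F →L[ℝ] LinearMap.range (R : F →ₗ[ℝ] G) :=
    R.codRestrict _ fun x => LinearMap.mem_range_self _ x
  refine ⟨_, fun i => (LinearMap.toContinuousLinearMap (b.coord i)).comp R', fun i => b i,
    fun x => ?_⟩
  have := congrArg Subtype.val (b.sum_repr (R' x))
  simp only [Submodule.coe_sum, Submodule.coe_smul] at this
  exact this.symm

/-- A summable family of nonnegative numbers remains summable after division by the terms of a
suitable null sequence. -/
theorem exists_tendsto_zero_summable_div {a : ℕ → ℝ} (ha0 : ∀ j, 0 ≤ a j) (ha : Summable a) :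
    ∃ r : ℕ → ℝ, (∀ j, 0 ≤ r j) ∧ Filter.Tendsto r Filter.atTop (nhds 0) ∧
      (Summable fun j => a j / r j) ∧ ∀ j, r j = 0 → a j = 0 := by
  set T : ℕ → ℝ := fun j => ∑' i, a (i + j) with hT
  have hT0 : ∀ j, 0 ≤ T j := fun j => tsum_nonneg fun i => ha0 _
  have hTs : ∀ j, T j = a j + T (j + 1) := fun j => by
    have h := ((summable_nat_add_iff j).2 ha).tsum_eq_zero_add
    simp only [zero_add] at h
    rw [hT]
    simp only
    rw [h]
    congr 2
    funext i
    congr 1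
    ring
  -- With `r j` the root of the tail sum `T j`, factoring `a j = T j - T (j + 1)` as a difference of
  -- squares bounds the quotient by a telescoping term.
  have hle : ∀ j, a j / √(T j) ≤ 2 * (√(T j) - √(T (j + 1))) := fun j => by
    have hmono : √(T (j + 1)) ≤ √(T j) := Real.sqrt_le_sqrt (by linarith [hTs j, ha0 j])
    rcases (Real.sqrt_nonneg (T j)).eq_or_lt with h0 | h0
    · rw [← h0, div_zero]
      have := Real.sqrt_nonneg (T (j + 1))
      linarith
    · rw [div_le_iff₀ h0]
      have h1 := Real.mul_self_sqrt (hT0 j)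
      have h2 := Real.mul_self_sqrt (hT0 (j + 1))
      nlinarith [hTs j, Real.sqrt_nonneg (T (j + 1))]
  refine ⟨fun j => √(T j), fun j => Real.sqrt_nonneg _, ?_, ?_, fun j hj => ?_⟩
  · have := (tendsto_sum_nat_add a).sqrt
    rwa [Real.sqrt_zero] at this
  · refine summable_of_sum_range_le (c := 2 * √(T 0))
      (fun j => div_nonneg (ha0 j) (Real.sqrt_nonneg _)) fun n => ?_
    refine (Finset.sum_le_sum fun j _ => hle j).trans ?_
    rw [← Finset.mul_sum, Finset.sum_range_sub']
    have := Real.sqrt_nonneg (T n)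
    linarith
  · have h1 : T j = 0 := (Real.sqrt_eq_zero (hT0 j)).1 hj
    linarith [hTs j, ha0 j, hT0 (j + 1)]

/-- In a space with the approximation property, the trace of a nuclear representation of the zero
operator vanishes. -/
theorem HasAP.tsum_trace_eq_zero {F : Type*} [NormedAddCommGroup F] [NormedSpace ℝ F]
    (hF : HasAP F) {v : ℕ → F} {w : ℕ → StrongDual ℝ F} (hs : Summable fun j => ‖v j‖ * ‖w j‖)
    (h0 : ∀ h : F, HasSum (fun j => w j h • v j) 0) : ∑' j, w j (v j) = 0 := by
  obtain ⟨r, hr0, hr, hrs, hra⟩ := exists_tendsto_zero_summable_div (fun j => by positivity) hs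
  set S := ∑' j, ‖v j‖ * ‖w j‖ / r j with hS
  have hS0 : 0 ≤ S := tsum_nonneg fun j => div_nonneg (by positivity) (hr0 j)
  suffices key : ∀ ε > 0, |∑' j, w j (v j)| ≤ ε * S by
    have hlim : Filter.Tendsto (fun ε : ℝ => ε * S) (nhdsWithin 0 (Set.Ioi 0))
        (nhds (0 * S)) :=
      (Continuous.tendsto (by fun_prop) 0).mono_left nhdsWithin_le_nhds
    have := ge_of_tendsto hlim (by filter_upwards [self_mem_nhdsWithin] with ε hε using key ε hε)
    rw [zero_mul] at this
    exact abs_nonpos_iff.1 this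
  intro ε hε
  -- Rescaled to norm at most `r j`, the vectors together with `0` form a compact set; the weights
  -- `1 / r j` lost in rescaling remain summable.
  have hv' : Filter.Tendsto (fun j => (r j / ‖v j‖) • v j) Filter.atTop (nhds 0) := by
    refine squeeze_zero_norm (fun j => ?_) hr
    rw [norm_smul, Real.norm_of_nonneg (div_nonneg (hr0 j) (norm_nonneg _))]
    rcases eq_or_ne ‖v j‖ 0 with h | h
    · simp [h, hr0 j]
    · exact (div_mul_cancel₀ _ h).le
  obtain ⟨R, hR, hRε⟩ := hF ε hε _ hv'.isCompact_insert_range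
  have hbound : ∀ j, ‖w j (v j) - w j (R (v j))‖ ≤ ε * (‖v j‖ * ‖w j‖ / r j) := fun j => by
    rw [← map_sub]
    refine ((w j).le_opNorm _).trans ?_
    rcases eq_or_ne (‖v j‖ * ‖w j‖) 0 with h | h
    · rcases mul_eq_zero.1 h with h | h
      · rw [norm_eq_zero.1 h]
        simp
      · rw [h]
        simp
    have hvj : ‖v j‖ ≠ 0 := left_ne_zero_of_mul h
    have hrj : r j ≠ 0 := fun hj => h (hra j hj)
    have hrp : 0 < r j := (hr0 j).lt_of_ne' hrj
    have h1 := (hRε _ (Set.mem_insert_of_mem _ ⟨j, rfl⟩)).le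
    simp only [map_smul, ← smul_sub] at h1
    rw [norm_smul, Real.norm_of_nonneg (by positivity), norm_sub_rev] at h1
    have h2 : ‖v j - R (v j)‖ ≤ ε * (‖v j‖ / r j) := by
      calc ‖v j - R (v j)‖ = (r j / ‖v j‖ * ‖v j - R (v j)‖) * (‖v j‖ / r j) := by field_simp
        _ ≤ _ := by gcongr
    calc ‖w j‖ * ‖v j - R (v j)‖ ≤ ‖w j‖ * (ε * (‖v j‖ / r j)) := by gcongr
      _ = _ := by ring
  -- For finite rank `R` this trace is a finite combination of functionals applied to the zero sum.
  have hzero : HasSum (fun j => w j (R (v j))) 0 := by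
    obtain ⟨n, f, g, hfg⟩ := hR.exists_eq_sum
    have : HasSum (fun j => ∑ i, f i (w j (g i) • v j)) (∑ i : Fin n, f i 0) :=
      hasSum_sum fun i _ => (h0 (g i)).mapL (f i)
    simp only [map_zero, Finset.sum_const_zero] at this
    refine this.congr_fun fun j => ?_
    rw [hfg]
    simp [mul_comm]
  have hsum : HasSum (fun j => w j (v j) - w j (R (v j))) (∑' j, w j (v j)) := by
    have h1 : Summable fun j => w j (v j) :=
      Summable.of_norm_bounded hs fun j => ((w j).le_opNorm _).trans_eq (mul_comm _ _)
    simpa using h1.hasSum.sub hzero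
  rw [← hsum.tsum_eq]
  refine (tsum_of_norm_bounded (hrs.hasSum.mul_left ε) hbound)

end ApproximationProperty

/-! ### Traces of nuclear representations against bounded forms -/

section Trace

variable {E Y : Type*} [NormedAddCommGroup E] [NormedSpace ℝ E]
  [NormedAddCommGroup Y] [NormedSpace ℝ Y] [Preorder Y] {p : ℝ≥0∞} {C : ℝ}

theorem IsBoundedForm.abs_sum_le {F : Type*} [NormedAddCommGroup F] [NormedSpace ℝ F]
    {B : F →L[ℝ] StrongDual ℝ Y} (hp : 1 ≤ p)
    (h : IsBoundedForm p C B) {v : ℕ → F} {y : ℕ → Y} {α β : ℝ}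
    (hα : 0 ≤ α) (hβ : 0 ≤ β) (hv : strongNorm p v ≤ ENNReal.ofReal α)
    (hy : weakNorm p.conjExponent y ≤ ENNReal.ofReal β) (hy0 : ∀ j, 0 ≤ y j) (s : Finset ℕ) :
    |∑ j ∈ s, B (v j) (y j)| ≤ C * α * β := by
  refine abs_le'.2 ⟨h s v y α β hα hβ hv hy hy0, ?_⟩
  have h2 := h s (fun j => (-1 : ℝ) • v j) y α β hα hβ
    (by rw [strongNorm_const_smul hp]; simpa using hv) hy hy0
  simpa using h2

theorem IsBoundedForm.summable {F : Type*} [NormedAddCommGroup F] [NormedSpace ℝ F]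
    {B : F →L[ℝ] StrongDual ℝ Y}
    (h : IsBoundedForm p C B) {v : ℕ → F} {y : ℕ → Y} {α β : ℝ}
    (hα : 0 ≤ α) (hβ : 0 ≤ β) (hv : strongNorm p v ≤ ENNReal.ofReal α)
    (hy : weakNorm p.conjExponent y ≤ ENNReal.ofReal β) (hy0 : ∀ j, 0 ≤ y j) :
    Summable fun j => B (v j) (y j) := by
  refine Summable.of_abs (summable_of_sum_le (c := C * α * β) (fun j => abs_nonneg _) fun s => ?_)
  -- Signs are absorbed into `v`, which does not increase its strong norm; the bound on finite sums
  -- thus becomes a bound on sums of absolute values.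
  have h2 := h s (fun j => (SignType.sign (B (v j) (y j)) : ℝ) • v j) y α β hα hβ
    ((strongNorm_mono fun j => ?_).trans hv) hy hy0
  · simpa [sign_mul_self] using h2
  · rw [norm_smul]
    refine mul_le_of_le_one_left (norm_nonneg _) ?_
    rcases SignType.sign (B (v j) (y j)) <;> simp

theorem IsBoundedForm.abs_tsum_le {F : Type*} [NormedAddCommGroup F] [NormedSpace ℝ F]
    {B : F →L[ℝ] StrongDual ℝ Y} (hp : 1 ≤ p)
    (h : IsBoundedForm p C B) {v : ℕ → F} {y : ℕ → Y} {α β : ℝ}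
    (hα : 0 ≤ α) (hβ : 0 ≤ β) (hv : strongNorm p v ≤ ENNReal.ofReal α)
    (hy : weakNorm p.conjExponent y ≤ ENNReal.ofReal β) (hy0 : ∀ j, 0 ≤ y j) :
    |∑' j, B (v j) (y j)| ≤ C * α * β :=
  le_of_tendsto ((h.summable hα hβ hv hy hy0).hasSum.abs)
    (Filter.Eventually.of_forall fun s => h.abs_sum_le hp hα hβ hv hy hy0 s)

/-- The `v j` with the functionals `B.flip (y j)` form a nuclear representation on `E*`. Evaluated
at `e`, the operator it represents sends `g` to `B g (t e) = 0`. -/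
theorem HasAP.tsum_form_eq_zero (hE : HasAP (StrongDual ℝ E))
    {B : StrongDual ℝ E →L[ℝ] StrongDual ℝ Y} (hB : IsBoundedForm p C B) {t : E →L[ℝ] Y}
    {v : ℕ → StrongDual ℝ E} {y : ℕ → Y} (h : IsLatticiallyNuclearRep p t v y)
    (h0 : ∀ f e, B f (t e) = 0) : ∑' j, B (v j) (y j) = 0 := by
  have hw : ∀ j, ∃ f : StrongDual ℝ E, ‖f‖ ≤ 1 ∧ ‖B.flip (y j)‖ ≤ 2 * B f (y j) := fun j => by
    rcases eq_or_ne ‖B.flip (y j)‖ 0 with h | h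
    · exact ⟨0, by simp, by simp [h]⟩
    obtain ⟨f, hf, hfy⟩ := (B.flip (y j)).exists_lt_apply_of_lt_opNorm
      (half_lt_self ((norm_nonneg _).lt_of_ne' h))
    rcases abs_cases (B f (y j)) with h' | h'
    · refine ⟨f, hf.le, ?_⟩
      rw [← h'.1]
      change _ < |B f (y j)| at hfy
      linarith
    · refine ⟨-f, by simpa using hf.le, ?_⟩
      rw [map_neg, neg_apply, ← h'.1]
      change _ < |B f (y j)| at hfy
      linarith
  choose f hf hfy using hw
  have hsum : Summable fun j => ‖v j‖ * ‖B.flip (y j)‖ := by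
    refine summable_of_sum_le (c := 2 * (C * (strongNorm p v).toReal *
      (weakNorm p.conjExponent y).toReal)) (fun j => by positivity) fun s => ?_
    -- Replacing `v j` by a vector of no larger norm that nearly norms `B.flip (y j)` makes the form
    -- bound control `∑ ‖v j‖ * ‖B.flip (y j)‖`. The factor `2` covers norms that are not attained.
    have := hB s (fun j => ‖v j‖ • f j) y _ _ ENNReal.toReal_nonneg ENNReal.toReal_nonneg
      ((strongNorm_mono fun j => ?_).trans (ENNReal.ofReal_toReal h.summable_left.1.ne).ge)
      (ENNReal.ofReal_toReal (ne_of_lt h.summable_right)).ge h.nonneg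
    · refine le_trans ?_ (mul_le_mul_of_nonneg_left this zero_le_two)
      rw [Finset.mul_sum]
      refine Finset.sum_le_sum fun j _ => ?_
      have := mul_le_mul_of_nonneg_left (hfy j) (norm_nonneg (v j))
      simp only [map_smul, smul_apply, smul_eq_mul]
      linarith
    · rw [norm_smul, norm_norm]
      exact mul_le_of_le_one_right (norm_nonneg _) (hf j)
  refine hE.tsum_trace_eq_zero (w := fun j => B.flip (y j)) hsum fun g => ?_
  have hs : Summable fun j => B.flip (y j) g • v j := by
    refine Summable.of_norm_bounded (hsum.mul_right ‖g‖) fun j => ?_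
    rw [norm_smul]
    calc _ ≤ (‖B.flip (y j)‖ * ‖g‖) * ‖v j‖ := by gcongr; exact ContinuousLinearMap.le_opNorm _ _
      _ = _ := by ring
  suffices h3 : ∑' j, B.flip (y j) g • v j = 0 from h3 ▸ hs.hasSum
  ext e
  have h1 : HasSum (fun j => (B.flip (y j) g • v j) e) ((∑' j, B.flip (y j) g • v j) e) :=
    hs.hasSum.mapL (ContinuousLinearMap.apply ℝ ℝ e)
  have h2 : HasSum (fun j => B g (tensorOp (v j) (y j) e)) (B g (t e)) :=
    (h.hasSum.mapL (ContinuousLinearMap.apply ℝ Y e)).mapL (B g)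
  rw [h0] at h2
  refine h1.unique (h2.congr_fun fun j => ?_)
  simp [tensorOp_apply, mul_comm]

/-- After composition with a finite rank operator the trace depends only on `t`, not on the
representation. -/
theorem hasSum_form_comp_finiteRank {B : StrongDual ℝ E →L[ℝ] StrongDual ℝ Y} {t : E →L[ℝ] Y}
    {v : ℕ → StrongDual ℝ E} {y : ℕ → Y} (h : HasSum (fun j => tensorOp (v j) (y j)) t)
    {n : ℕ} {f : Fin n → StrongDual ℝ Y} {g : Fin n → Y} {R : Y →L[ℝ] Y}
    (hfg : ∀ x, R x = ∑ i, f i x • g i) :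
    HasSum (fun j => B (v j) (R (y j))) (∑ i, B ((f i).comp t) (g i)) := by
  have h1 : ∀ i, HasSum (fun j => B ((f i).comp (tensorOp (v j) (y j))) (g i))
      (B ((f i).comp t) (g i)) := fun i =>
    ((h.mapL (ContinuousLinearMap.compL ℝ E Y ℝ (f i))).mapL B).mapL
      (ContinuousLinearMap.apply ℝ ℝ (g i))
  refine (hasSum_sum fun i _ => h1 i).congr_fun fun j => ?_
  rw [hfg, map_sum]
  refine Finset.sum_congr rfl fun i _ => ?_
  have h2 : (f i).comp (tensorOp (v j) (y j)) = f i (y j) • v j := by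
    ext e
    simp [tensorOp_apply, mul_comm]
  rw [h2]
  simp

theorem tsum_form_eq_sum_add {F : Type*} [NormedAddCommGroup F] [NormedSpace ℝ F]
    {B : F →L[ℝ] StrongDual ℝ Y} {v : ℕ → F} {y : ℕ → Y} (N : ℕ)
    (hs : Summable fun j => B (v j) (y j)) :
    ∑' j, B (v j) (y j) = ∑ j ∈ Finset.range N, B (v j) (y j)
      + ∑' j, B ((Set.Ici N).indicator v j) (y j) := by
  have h1 : HasSum ((Finset.range N : Set ℕ).indicator fun j => B (v j) (y j))
      (∑ j ∈ Finset.range N, B (v j) (y j)) := hasSum_subtype_iff_indicator.1 (Finset.hasSum _ _)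
  rw [← sub_eq_iff_eq_add', ← (hs.hasSum.sub h1).tsum_eq]
  refine tsum_congr fun j => ?_
  by_cases hj : N ≤ j
  · simp [hj]
  · simp [hj, not_le.1 hj]

/-- Both traces are compared with the common finite rank trace. As `R` is a positive contraction, `R
(y j)` stays positive with no larger weak norm; so the tails are small uniformly in `R`, and `N` can
be fixed before `R`. -/
theorem HasPMAP.tsum_form_eq (hY : HasPMAP Y) (hp : 1 ≤ p) (hC : 0 ≤ C)
    {B : StrongDual ℝ E →L[ℝ] StrongDual ℝ Y} (hB : IsBoundedForm p C B) {t : E →L[ℝ] Y}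
    {v : ℕ → StrongDual ℝ E} {y y' : ℕ → Y} (h : IsLatticiallyNuclearRep p t v y)
    (h' : IsLatticiallyNuclearRep p t v y') :
    ∑' j, B (v j) (y j) = ∑' j, B (v j) (y' j) := by
  set A := (strongNorm p v).toReal
  set W := (weakNorm p.conjExponent y).toReal + (weakNorm p.conjExponent y').toReal
  have hA0 : 0 ≤ A := ENNReal.toReal_nonneg
  have hA : strongNorm p v ≤ ENNReal.ofReal A := (ENNReal.ofReal_toReal h.summable_left.1.ne).ge
  have hW1 : 0 ≤ (weakNorm p.conjExponent y).toReal := ENNReal.toReal_nonneg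
  have hW2 : 0 ≤ (weakNorm p.conjExponent y').toReal := ENNReal.toReal_nonneg
  have hW0 : 0 ≤ W := by positivity
  have hy : weakNorm p.conjExponent y ≤ ENNReal.ofReal W :=
    (ENNReal.ofReal_toReal (ne_of_lt h.summable_right)).ge.trans
      (ENNReal.ofReal_le_ofReal (le_add_of_nonneg_right hW2))
  have hy' : weakNorm p.conjExponent y' ≤ ENNReal.ofReal W :=
    (ENNReal.ofReal_toReal (ne_of_lt h'.summable_right)).ge.trans
      (ENNReal.ofReal_le_ofReal (le_add_of_nonneg_left hW1))
  refine eq_of_abs_sub_le_all fun ε hε => ?_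
  set η := ε / (8 * (C * W + 1))
  have hη : 0 < η := by positivity
  have hηε : C * η * W ≤ ε / 8 := by
    have : C * η * W = (C * W) * ε / (8 * (C * W + 1)) := by simp only [η]; ring
    rw [this, div_le_div_iff₀ (by positivity) (by positivity)]
    have : 0 ≤ C * W := by positivity
    nlinarith
  obtain ⟨N, hN⟩ := h.summable_left.exists_tail_lt hp (ENNReal.ofReal_pos.2 hη)
  set D := ∑ j ∈ Finset.range N, ‖B‖ * ‖v j‖
  have hD0 : 0 ≤ D := by positivity
  -- The first `N` terms cost at most `D * δ ≤ ε / 4`, and the two tails at most `ε / 8` each.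
  set δ := ε / (4 * (D + 1))
  have hδ : 0 < δ := by positivity
  have hδε : D * δ ≤ ε / 4 := by
    have : D * δ = D * ε / (4 * (D + 1)) := by simp only [δ]; ring
    rw [this, div_le_div_iff₀ (by positivity) (by positivity)]
    nlinarith
  obtain ⟨R, hRf, hRp, hR1, hRδ⟩ := hY δ hδ (y '' (Finset.range N) ∪ y' '' (Finset.range N))
    (((Finset.range N).finite_toSet.image y).union
      ((Finset.range N).finite_toSet.image y')).isCompact
  obtain ⟨n, f, g, hfg⟩ := hRf.exists_eq_sum
  have key : ∀ z : ℕ → Y, IsLatticiallyNuclearRep p t v z →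
      weakNorm p.conjExponent z ≤ ENNReal.ofReal W →
      (∀ j ∈ Finset.range N, ‖R (z j) - z j‖ < δ) →
      |∑' j, B (v j) (z j) - ∑ i, B ((f i).comp t) (g i)| ≤ ε / 2 := by
    intro z hz hzW hzδ
    have hRz := (weakNorm_map_le R hR1 z).trans hzW
    have hRz0 : ∀ j, 0 ≤ R (z j) := fun j => hRp _ (hz.nonneg j)
    rw [← (hasSum_form_comp_finiteRank (B := B) hz.hasSum hfg).tsum_eq,
      tsum_form_eq_sum_add N (hB.summable hA0 hW0 hA hzW hz.nonneg),
      tsum_form_eq_sum_add N (hB.summable hA0 hW0 hA hRz hRz0)]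
    have h1 := hB.abs_tsum_le hp hη.le hW0 hN.le hzW hz.nonneg
    have h2 := hB.abs_tsum_le hp hη.le hW0 hN.le hRz hRz0
    have h3 : |∑ j ∈ Finset.range N, B (v j) (z j) - ∑ j ∈ Finset.range N, B (v j) (R (z j))|
        ≤ D * δ := by
      rw [← Finset.sum_sub_distrib, Finset.sum_mul]
      refine (Finset.abs_sum_le_sum_abs _ _).trans (Finset.sum_le_sum fun j hj => ?_)
      rw [← map_sub]
      refine ((B (v j)).le_opNorm _).trans ?_
      rw [norm_sub_rev]
      exact mul_le_mul (B.le_opNorm _) (hzδ j hj).le (norm_nonneg _) (by positivity)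
    rw [abs_le] at h1 h2 h3 ⊢
    constructor <;> linarith [h1.1, h1.2, h2.1, h2.2, h3.1, h3.2]
  have k1 := key y h hy fun j hj => hRδ _ (Or.inl ⟨j, hj, rfl⟩)
  have k2 := key y' h' hy' fun j hj => hRδ _ (Or.inr ⟨j, hj, rfl⟩)
  rw [abs_le] at k1 k2 ⊢
  constructor <;> linarith [k1.1, k1.2, k2.1, k2.2]

end Trace

open NormedSpace (inclusionInDoubleDual)

/-! ### Adjoints, the canonical embeddings, and forms vanishing on `X` -/

section Bidual

variable {E X : Type*} [NormedAddCommGroup E] [NormedSpace ℝ E]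
  [NormedAddCommGroup X] [NormedSpace ℝ X]

theorem norm_adjointOp_le {F : Type*} [NormedAddCommGroup F] [NormedSpace ℝ F] (S : E →L[ℝ] F) :
    ‖adjointOp S‖ ≤ ‖S‖ :=
  ContinuousLinearMap.opNorm_le_bound _ (norm_nonneg _) fun f =>
    (ContinuousLinearMap.opNorm_comp_le f S).trans_eq (mul_comm _ _)

theorem IsPositiveOp.adjointOp {F : Type*} [NormedAddCommGroup F] [NormedSpace ℝ F] [Preorder E]
    [Preorder F] {S : E →L[ℝ] F} (hS : IsPositiveOp S) : IsPositiveOp (adjointOp S) :=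
  fun _ hf x hx => hf _ (hS x hx)

theorem norm_inclusionInDoubleDual_comp (S : E →L[ℝ] X) :
    ‖inclusionInDoubleDual ℝ X ∘L S‖ = ‖S‖ :=
  (NormedSpace.inclusionInDoubleDualLi ℝ (E := X)).norm_toContinuousLinearMap_comp

/-- The two canonical embeddings of `X**` into `X****` agree on `X`. -/
theorem adjointOp_adjointOp_comp_inclusionInDoubleDual (S : E →L[ℝ] X) :
    adjointOp (adjointOp (inclusionInDoubleDual ℝ X)) ∘L (inclusionInDoubleDual ℝ X ∘L S)
      = inclusionInDoubleDual ℝ (StrongDual ℝ (StrongDual ℝ X)) ∘L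
        (inclusionInDoubleDual ℝ X ∘L S) := by
  ext e g
  rfl

variable [Preorder X] {p : ℝ≥0∞}

/-- The adjoint of `S` and `J ∘ S` are flips of each other, and flipping is an isometry that
exchanges the factors of a tensor; convergence of the series therefore transfers both ways. -/
theorem isPositivelyNuclearRep_adjointOp_iff {S : E →L[ℝ] X}
    {φ : ℕ → StrongDual ℝ (StrongDual ℝ X)} {v : ℕ → StrongDual ℝ E} :
    IsPositivelyNuclearRep p (adjointOp S) φ v ↔
      IsLatticiallyNuclearRep p (inclusionInDoubleDual ℝ X ∘L S) v φ := by
  have hS : ContinuousLinearMap.flip (inclusionInDoubleDual ℝ X ∘L S) = adjointOp S := rfl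
  have hS' : ContinuousLinearMap.flip (adjointOp S) = inclusionInDoubleDual ℝ X ∘L S := rfl
  have ht : ∀ j, ContinuousLinearMap.flip (tensorOp (v j) (φ j)) = tensorOp (φ j) (v j) :=
    fun j => by
      ext f e
      simp [tensorOp_apply, mul_comm]
  have ht' : ∀ j, ContinuousLinearMap.flip (tensorOp (φ j) (v j)) = tensorOp (v j) (φ j) :=
    fun j => by
      rw [← ht, ContinuousLinearMap.flip_flip]
  constructor
  · intro h
    refine ⟨h.summable_right, h.summable_left, h.nonneg, ?_⟩
    have := h.hasSum.mapL (ContinuousLinearMap.flipₗᵢ ℝ (StrongDual ℝ X) E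
      ℝ).toContinuousLinearEquiv.toContinuousLinearMap
    rw [← hS']
    refine this.congr_fun fun j => ?_
    exact (ht' j).symm
  · intro h
    refine ⟨h.summable_right, h.nonneg, h.summable_left, ?_⟩
    have := h.hasSum.mapL (ContinuousLinearMap.flipₗᵢ ℝ E (StrongDual ℝ X)
      ℝ).toContinuousLinearEquiv.toContinuousLinearMap
    rw [← hS]
    refine this.congr_fun fun j => ?_
    exact (ht j).symm

theorem positivelyNuclearNorm_adjointOp (S : E →L[ℝ] X) :
    positivelyNuclearNorm p (adjointOp S)
      = latticiallyNuclearNorm p (inclusionInDoubleDual ℝ X ∘L S) := by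
  unfold positivelyNuclearNorm latticiallyNuclearNorm
  rw [iInf_comm]
  simp_rw [isPositivelyNuclearRep_adjointOp_iff, mul_comm]

theorem HasPMAP.tsum_form_map_eq {Y Z : Type*} [NormedAddCommGroup Y] [NormedSpace ℝ Y]
    [Preorder Y] [NormedAddCommGroup Z] [NormedSpace ℝ Z] [Preorder Z] (hZ : HasPMAP Z)
    (hp : 1 ≤ p) {C : ℝ} (hC : 0 ≤ C) {B : StrongDual ℝ E →L[ℝ] StrongDual ℝ Z}
    (hB : IsBoundedForm p C B) {T₁ T₂ : Y →L[ℝ] Z} (h₁ : ‖T₁‖ ≤ 1) (h₁' : IsPositiveOp T₁)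
    (h₂ : ‖T₂‖ ≤ 1) (h₂' : IsPositiveOp T₂) {t : E →L[ℝ] Y} (ht : T₂ ∘L t = T₁ ∘L t)
    {v : ℕ → StrongDual ℝ E} {y : ℕ → Y} (hr : IsLatticiallyNuclearRep p t v y) :
    ∑' j, B (v j) (T₁ (y j)) = ∑' j, B (v j) (T₂ (y j)) :=
  hZ.tsum_form_eq hp hC hB (hr.map T₁ h₁ h₁') (ht ▸ hr.map T₂ h₂ h₂')

/-- Along the canonical embedding the extended form returns the values of `B`; the PMAP of `Y**`
allows replacing that embedding by `T`. -/
theorem HasPMAP.tsum_form_eq_tsum_bidual {Y : Type*} [NormedAddCommGroup Y] [NormedSpace ℝ Y]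
    [Preorder Y] [IsOrderedAddMonoid Y] [PosSMulMono ℝ Y]
    (hY : HasPMAP (StrongDual ℝ (StrongDual ℝ Y))) (hp : 1 ≤ p) {C : ℝ} (hC : 0 ≤ C)
    {B : StrongDual ℝ E →L[ℝ] StrongDual ℝ Y} (hB : IsBoundedForm p C B)
    {T : Y →L[ℝ] StrongDual ℝ (StrongDual ℝ Y)} (hT : ‖T‖ ≤ 1) (hT' : IsPositiveOp T)
    {t : E →L[ℝ] Y} (ht : T ∘L t = inclusionInDoubleDual ℝ Y ∘L t)
    {v : ℕ → StrongDual ℝ E} {y : ℕ → Y} (hr : IsLatticiallyNuclearRep p t v y) :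
    ∑' j, B (v j) (y j) = ∑' j, T (y j) (B (v j)) :=
  hY.tsum_form_map_eq hp hC (hB.bidual hp hC) (NormedSpace.inclusionInDoubleDual_norm_le ℝ Y)
    inclusionInDoubleDual_isPositiveOp hT hT' ht hr

/-- Under either approximation hypothesis, a bounded form on `E* × X**` which vanishes on
`E* × X` has trace zero on every operator with values in `X`. -/
theorem tsum_form_eq_zero_of_vanish [IsOrderedAddMonoid X] [PosSMulMono ℝ X] (hp : 1 ≤ p)
    (h : HasAP (StrongDual ℝ E) ∨
      HasPMAP (StrongDual ℝ (StrongDual ℝ (StrongDual ℝ (StrongDual ℝ X)))))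
    {C : ℝ} (hC : 0 ≤ C)
    {B : StrongDual ℝ E →L[ℝ] StrongDual ℝ (StrongDual ℝ (StrongDual ℝ X))}
    (hB : IsBoundedForm p C B) (hBX : ∀ f x, B f (inclusionInDoubleDual ℝ X x) = 0)
    {S : E →L[ℝ] X} {v : ℕ → StrongDual ℝ E} {φ : ℕ → StrongDual ℝ (StrongDual ℝ X)}
    (hr : IsLatticiallyNuclearRep p (inclusionInDoubleDual ℝ X ∘L S) v φ) :
    ∑' j, B (v j) (φ j) = 0 := by
  rcases h with hE | hX
  · exact hE.tsum_form_eq_zero hB hr fun f e => hBX f (S e)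
  -- Here `T` is the second adjoint of `J`. It moves `B (v j)` to its restriction to `X`, which is
  -- zero.
  have hJ2 : ‖adjointOp (adjointOp (inclusionInDoubleDual ℝ X))‖ ≤ 1 :=
    (norm_adjointOp_le _).trans ((norm_adjointOp_le _).trans
      (NormedSpace.inclusionInDoubleDual_norm_le ℝ X))
  rw [hX.tsum_form_eq_tsum_bidual hp hC hB hJ2
    inclusionInDoubleDual_isPositiveOp.adjointOp.adjointOp
    (adjointOp_adjointOp_comp_inclusionInDoubleDual S) hr]
  refine (tsum_congr fun j => ?_).trans tsum_zero
  have h0 : adjointOp (inclusionInDoubleDual ℝ X) (B (v j)) = 0 :=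
    ContinuousLinearMap.ext fun x => hBX (v j) x
  change φ j (adjointOp (inclusionInDoubleDual ℝ X) (B (v j))) = 0
  rw [h0, map_zero]

end Bidual

/-! ### The splitting norm, its dual forms, and successive approximation -/

section Splitting

variable {E X Y : Type*} [NormedAddCommGroup E] [NormedSpace ℝ E]
  [NormedAddCommGroup X] [NormedSpace ℝ X] [Preorder X]
  [NormedAddCommGroup Y] [NormedSpace ℝ Y] [Preorder Y] {p : ℝ≥0∞} {κ : ℝ≥0∞} {J : X →L[ℝ] Y}

/-- The norm on operators `E → Y` which interpolates, along `J : X → Y`, between the latticially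
nuclear norm of operators into `X` and a multiple of the latticially nuclear norm. -/
noncomputable def splittingNorm (p κ : ℝ≥0∞) (J : X →L[ℝ] Y) (t : E →L[ℝ] Y) : ℝ≥0∞ :=
  ⨅ s : E →L[ℝ] X, latticiallyNuclearNorm p s + κ * latticiallyNuclearNorm p (t - J ∘L s)

theorem splittingNorm_comp_le (hp : 1 ≤ p) (s : E →L[ℝ] X) :
    splittingNorm p κ J (J ∘L s) ≤ latticiallyNuclearNorm p s :=
  (iInf_le _ s).trans (by simp [latticiallyNuclearNorm_zero hp])

theorem splittingNorm_le (hp : 1 ≤ p) (t : E →L[ℝ] Y) :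
    splittingNorm p κ J t ≤ κ * latticiallyNuclearNorm p t :=
  (iInf_le _ 0).trans (by simp [latticiallyNuclearNorm_zero hp])

theorem splittingNorm_smul_le (hp : 1 ≤ p) {c : ℝ} (hc : c ≠ 0) (t : E →L[ℝ] Y) :
    splittingNorm p κ J (c • t) ≤ ‖c‖ₑ * splittingNorm p κ J t := by
  unfold splittingNorm
  rw [ENNReal.mul_iInf_of_ne (by simpa using hc) enorm_ne_top]
  refine le_iInf fun s => (iInf_le _ (c • s)).trans ?_
  rw [ContinuousLinearMap.comp_smul, ← smul_sub, mul_add, mul_left_comm]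
  gcongr <;> exact latticiallyNuclearNorm_smul_le hp hc _

theorem splittingNorm_add_le [CompleteSpace X] [PosSMulMono ℝ X] [CompleteSpace Y]
    [PosSMulMono ℝ Y] (hp : 1 ≤ p) (t t' : E →L[ℝ] Y) :
    splittingNorm p κ J (t + t') ≤ splittingNorm p κ J t + splittingNorm p κ J t' := by
  conv_rhs => unfold splittingNorm
  rw [ENNReal.iInf_add]
  refine le_iInf fun s => ?_
  rw [ENNReal.add_iInf]
  refine le_iInf fun s' => (iInf_le _ (s + s')).trans ?_
  rw [ContinuousLinearMap.comp_add, add_sub_add_comm, add_add_add_comm, ← mul_add]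
  gcongr <;> exact latticiallyNuclearNorm_add_le hp _ _

/-- The space of latticially `p`-nuclear operators. -/
def latticiallyNuclearOps (E Y : Type*) [NormedAddCommGroup E] [NormedSpace ℝ E]
    [NormedAddCommGroup Y] [NormedSpace ℝ Y] [Preorder Y] [CompleteSpace Y] [PosSMulMono ℝ Y]
    {p : ℝ≥0∞} (hp : 1 ≤ p) : Submodule ℝ (E →L[ℝ] Y) where
  carrier := {t | latticiallyNuclearNorm p t < ∞}
  add_mem' hs ht := (latticiallyNuclearNorm_add_le hp _ _).trans_lt (ENNReal.add_lt_top.2 ⟨hs, ht⟩)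
  zero_mem' := by simp [latticiallyNuclearNorm_zero hp]
  smul_mem' c t ht := by
    rcases eq_or_ne c 0 with rfl | hc
    · simp [latticiallyNuclearNorm_zero hp]
    · exact (latticiallyNuclearNorm_smul_le hp hc t).trans_lt
        (ENNReal.mul_lt_top enorm_lt_top ht)

/-- Write `φ = ψ - (ψ - φ)` with a positive majorant `ψ` of norm at most `‖φ‖`; the two positive
pieces contribute `1 + 2 = 3`. This is what makes the form induced by a functional jointly
continuous. -/
theorem latticiallyNuclearNorm_tensorOp_dual_le [IsOrderedAddMonoid Y] [PosSMulMono ℝ Y] (hp : 1 ≤ p)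
    (hY : ∀ a b : Y, 0 ≤ a → 0 ≤ b → ‖a‖ ≤ ‖a + b‖) (v : StrongDual ℝ E) (φ : StrongDual ℝ Y) :
    latticiallyNuclearNorm p (tensorOp v φ) ≤ ENNReal.ofReal (3 * ‖v‖ * ‖φ‖) := by
  obtain ⟨ψ, hψ0, hψφ, hψ⟩ := exists_nonneg_ge_of_norm_mono hY φ
  have h1 : tensorOp v φ = tensorOp v ψ + -tensorOp v (ψ - φ) := by
    ext e : 1
    simp [tensorOp_apply, smul_sub]
  have h2 : ‖ψ - φ‖ ≤ 2 * ‖φ‖ := (norm_sub_le _ _).trans (by linarith)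
  have h3 : (0 : StrongDual ℝ Y) ≤ ψ - φ := sub_nonneg.2 hψφ
  rw [h1]
  refine (latticiallyNuclearNorm_add_le hp _ _).trans ?_
  rw [latticiallyNuclearNorm_neg hp]
  refine (add_le_add (latticiallyNuclearNorm_tensorOp_le hp v hψ0)
    (latticiallyNuclearNorm_tensorOp_le hp v h3)).trans ?_
  rw [← mul_add, ← ofReal_norm, ← ofReal_norm, ← ofReal_norm,
    ← ENNReal.ofReal_add (norm_nonneg _) (norm_nonneg _), ← ENNReal.ofReal_mul (norm_nonneg _)]
  refine ENNReal.ofReal_le_ofReal ?_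
  calc ‖v‖ * (‖ψ‖ + ‖ψ - φ‖) ≤ ‖v‖ * (‖φ‖ + 2 * ‖φ‖) := by gcongr
    _ = _ := by ring

theorem tensorOp_add_left {F : Type*} [NormedAddCommGroup F] [NormedSpace ℝ F]
    (f g : StrongDual ℝ E) (y : F) : tensorOp (f + g) y = tensorOp f y + tensorOp g y := by
  ext e
  simp [tensorOp_apply, add_smul]

theorem tensorOp_smul_left {F : Type*} [NormedAddCommGroup F] [NormedSpace ℝ F]
    (c : ℝ) (f : StrongDual ℝ E) (y : F) : tensorOp (c • f) y = c • tensorOp f y := by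
  ext e
  simp [tensorOp_apply, mul_smul]

theorem tensorOp_add_right {F : Type*} [NormedAddCommGroup F] [NormedSpace ℝ F]
    (f : StrongDual ℝ E) (y z : F) : tensorOp f (y + z) = tensorOp f y + tensorOp f z := by
  ext e
  simp [tensorOp_apply]

theorem tensorOp_smul_right {F : Type*} [NormedAddCommGroup F] [NormedSpace ℝ F]
    (c : ℝ) (f : StrongDual ℝ E) (y : F) : tensorOp f (c • y) = c • tensorOp f y := by
  ext e
  exact smul_comm _ _ _

/-- The bounded form induced by a functional on the space of latticially nuclear operators. -/
theorem exists_form_of_functional [CompleteSpace Y] [PosSMulMono ℝ Y] (hp : 1 ≤ p)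
    {c₀ : ℝ} (hc₀ : 0 ≤ c₀) (hbd : ∀ (f : StrongDual ℝ E) (y : Y),
      latticiallyNuclearNorm p (tensorOp f y) ≤ ENNReal.ofReal (c₀ * ‖f‖ * ‖y‖))
    (Λ : latticiallyNuclearOps E Y hp →ₗ[ℝ] ℝ) {k : ℝ} (hk : 0 ≤ k)
    (hΛ : ∀ (t : latticiallyNuclearOps E Y hp) (c : ℝ), 0 ≤ c →
      latticiallyNuclearNorm p t.1 ≤ ENNReal.ofReal c → Λ t ≤ k * c) :
    ∃ B : StrongDual ℝ E →L[ℝ] StrongDual ℝ Y, IsBoundedForm p k B ∧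
      (∀ (s : Finset ℕ) (f : ℕ → StrongDual ℝ E) (y : ℕ → Y)
        (t : latticiallyNuclearOps E Y hp), t.1 = ∑ j ∈ s, tensorOp (f j) (y j) →
        ∑ j ∈ s, B (f j) (y j) = Λ t) ∧
      (∀ (t : latticiallyNuclearOps E Y hp) (v : ℕ → StrongDual ℝ E) (y : ℕ → Y),
        IsLatticiallyNuclearRep p t.1 v y → ∑' j, B (v j) (y j) = Λ t) := by
  have hΛabs : ∀ (t : latticiallyNuclearOps E Y hp) (c : ℝ), 0 ≤ c →
      latticiallyNuclearNorm p t.1 ≤ ENNReal.ofReal c → |Λ t| ≤ k * c := fun t c hc htc => by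
    refine abs_le'.2 ⟨hΛ t c hc htc, ?_⟩
    rw [← map_neg]
    exact hΛ (-t) c hc (by
      rw [Submodule.coe_neg, latticiallyNuclearNorm_neg hp]
      exact htc)
  have hmem : ∀ (f : StrongDual ℝ E) (y : Y), tensorOp f y ∈ latticiallyNuclearOps E Y hp :=
    fun f y => (hbd f y).trans_lt ENNReal.ofReal_lt_top
  obtain ⟨B₀, hB₀⟩ : ∃ B₀ : StrongDual ℝ E →ₗ[ℝ] Y →ₗ[ℝ] ℝ,
      ∀ f y, B₀ f y = Λ ⟨tensorOp f y, hmem f y⟩ :=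
    ⟨LinearMap.mk₂ ℝ (fun f y => Λ ⟨tensorOp f y, hmem f y⟩)
      (fun f f' y => by
        rw [← map_add]
        exact congrArg Λ (Subtype.ext (tensorOp_add_left f f' y)))
      (fun c f y => by
        rw [← map_smul]
        exact congrArg Λ (Subtype.ext (tensorOp_smul_left c f y)))
      (fun f y y' => by
        rw [← map_add]
        exact congrArg Λ (Subtype.ext (tensorOp_add_right f y y')))
      (fun c f y => by
        rw [← map_smul]
        exact congrArg Λ (Subtype.ext (tensorOp_smul_right c f y))), fun _ _ => rfl⟩
  obtain ⟨B, hBdef⟩ : ∃ B : StrongDual ℝ E →L[ℝ] StrongDual ℝ Y,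
      ∀ f y, B f y = Λ ⟨tensorOp f y, hmem f y⟩ :=
    ⟨LinearMap.mkContinuous₂ B₀ (k * c₀) fun f y => by
      rw [hB₀, Real.norm_eq_abs, show k * c₀ * ‖f‖ * ‖y‖ = k * (c₀ * ‖f‖ * ‖y‖) by ring]
      exact hΛabs _ _ (by positivity) (hbd f y), hB₀⟩
  have hBsum : ∀ (s : Finset ℕ) (f : ℕ → StrongDual ℝ E) (y : ℕ → Y)
      (t : latticiallyNuclearOps E Y hp), t.1 = ∑ j ∈ s, tensorOp (f j) (y j) →
      ∑ j ∈ s, B (f j) (y j) = Λ t := fun s f y t ht => by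
    simp_rw [hBdef]
    rw [← map_sum]
    congr 1
    ext1
    rw [ht, Submodule.coe_sum]
  have hB : IsBoundedForm p k B := by
    intro s f y α β hα hβ hf hy hy0
    rw [hBsum s f y ⟨_, Submodule.sum_mem _ fun j _ => hmem (f j) (y j)⟩ rfl, mul_assoc]
    refine hΛ _ _ (by positivity) ?_
    rw [ENNReal.ofReal_mul hα]
    exact (latticiallyNuclearNorm_sum_le hp s f (hy.trans_lt ENNReal.ofReal_lt_top) hy0).trans
      (mul_le_mul' hf hy)
  refine ⟨B, hB, hBsum, fun t v y hr => ?_⟩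
  have hsB := hB.summable ENNReal.toReal_nonneg ENNReal.toReal_nonneg
    (ENNReal.ofReal_toReal hr.summable_left.1.ne).ge
    (ENNReal.ofReal_toReal (ne_of_lt hr.summable_right)).ge hr.nonneg
  -- `Λ` is continuous only for the nuclear norm, so convergence of the partial sums in that norm is
  -- what is used.
  refine tendsto_nhds_unique hsB.hasSum.tendsto_sum_nat ?_
  rw [Metric.tendsto_atTop]
  intro ε hε
  have hk1 : 0 < ε / (k + 1) := by positivity
  obtain ⟨N, hN⟩ := hr.tendsto_tail hp _ (ENNReal.ofReal_pos.2 hk1)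
  refine ⟨N, fun n hn => ?_⟩
  set r : latticiallyNuclearOps E Y hp := ⟨∑ j ∈ Finset.range n, tensorOp (v j) (y j),
    Submodule.sum_mem _ fun j _ => hmem (v j) (y j)⟩ with hrdef
  have h1 : latticiallyNuclearNorm p (t - r).1 ≤ ENNReal.ofReal (ε / (k + 1)) := by
    rw [Submodule.coe_sub]
    exact (hN n hn).le
  rw [hBsum _ v y r rfl, dist_comm, Real.dist_eq, ← map_sub]
  refine (hΛabs (t - r) _ hk1.le h1).trans_lt ?_
  rw [mul_div_assoc', div_lt_iff₀ (by positivity)]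
  nlinarith

/-- The splitting norm of an operator is attained by a form which is bounded with constant `1`
on `E* × X`. -/
theorem exists_form_splittingNorm [CompleteSpace X] [PosSMulMono ℝ X] [CompleteSpace Y]
    [PosSMulMono ℝ Y] (hp : 1 ≤ p) {c₀ : ℝ} (hc₀ : 0 ≤ c₀)
    (hbd : ∀ (f : StrongDual ℝ E) (y : Y),
      latticiallyNuclearNorm p (tensorOp f y) ≤ ENNReal.ofReal (c₀ * ‖f‖ * ‖y‖))
    (hJ : ‖J‖ ≤ 1) (hJ' : IsPositiveOp J) {k : ℝ} (hk : 0 ≤ k) {z : E →L[ℝ] Y}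
    (hz : latticiallyNuclearNorm p z < ∞) :
    ∃ B : StrongDual ℝ E →L[ℝ] StrongDual ℝ Y, IsBoundedForm p k B ∧
      IsBoundedForm p 1 (adjointOp J ∘L B) ∧
      ∀ (v : ℕ → StrongDual ℝ E) (y : ℕ → Y), IsLatticiallyNuclearRep p z v y →
        splittingNorm p (ENNReal.ofReal k) J z = ENNReal.ofReal (∑' j, B (v j) (y j)) := by
  have hVfin : ∀ t : latticiallyNuclearOps E Y hp,
      splittingNorm p (ENNReal.ofReal k) J t.1 ≠ ∞ := fun t =>
    ((splittingNorm_le hp t.1).trans_lt (ENNReal.mul_lt_top ENNReal.ofReal_lt_top t.2)).ne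
  obtain ⟨Λ, hΛz, hΛ⟩ := exists_linear_le_sublinear
    (fun t : latticiallyNuclearOps E Y hp =>
      (splittingNorm p (ENNReal.ofReal k) J t.1).toReal)
    (fun c hc t => by
      have := ENNReal.toReal_mono (ENNReal.mul_ne_top enorm_ne_top (hVfin t))
        (splittingNorm_smul_le hp hc.ne' t.1)
      rw [ENNReal.toReal_mul, toReal_enorm, Real.norm_of_nonneg hc.le] at this
      exact this)
    (fun t t' => by
      have := ENNReal.toReal_mono (ENNReal.add_ne_top.2 ⟨hVfin t, hVfin t'⟩)
        (splittingNorm_add_le hp t.1 t'.1)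
      rwa [ENNReal.toReal_add (hVfin t) (hVfin t')] at this)
    (fun t => ENNReal.toReal_nonneg) ⟨z, hz⟩
  have hΛle : ∀ (t : latticiallyNuclearOps E Y hp) (c : ℝ), 0 ≤ c →
      latticiallyNuclearNorm p t.1 ≤ ENNReal.ofReal c → Λ t ≤ k * c := fun t c hc htc => by
    refine (hΛ t).trans (ENNReal.toReal_le_of_le_ofReal (by positivity) ?_)
    rw [ENNReal.ofReal_mul hk]
    exact (splittingNorm_le hp t.1).trans (mul_le_mul_right htc _)
  obtain ⟨B, hB, hBsum, hBtsum⟩ := exists_form_of_functional hp hc₀ hbd Λ hk hΛle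
  refine ⟨B, hB, ?_, fun v y hr => ?_⟩
  -- An operator that factors as `J ∘ s` is split by `s` with zero remainder, so on `E* × X` the
  -- constant is `1` instead of `k`.
  · intro s f x α β hα hβ hf hx hx0
    have h2 : J ∘L ∑ j ∈ s, tensorOp (f j) (x j) = ∑ j ∈ s, tensorOp (f j) (J (x j)) := by
      ext e
      simp [tensorOp_apply]
    have h3 : latticiallyNuclearNorm p (∑ j ∈ s, tensorOp (f j) (x j))
        ≤ ENNReal.ofReal (α * β) := by
      rw [ENNReal.ofReal_mul hα]
      exact (latticiallyNuclearNorm_sum_le hp s f (hx.trans_lt ENNReal.ofReal_lt_top) hx0).trans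
        (mul_le_mul' hf hx)
    have h4 : J ∘L ∑ j ∈ s, tensorOp (f j) (x j) ∈ latticiallyNuclearOps E Y hp :=
      ((latticiallyNuclearNorm_comp_le _ J hJ hJ').trans h3).trans_lt ENNReal.ofReal_lt_top
    have h1 : ∑ j ∈ s, B (f j) (J (x j)) = Λ ⟨_, h4⟩ := hBsum s f (fun j => J (x j)) _ h2
    change ∑ j ∈ s, B (f j) (J (x j)) ≤ _
    rw [h1, one_mul]
    exact (hΛ _).trans (ENNReal.toReal_le_of_le_ofReal (by positivity)
      ((splittingNorm_comp_le hp _).trans h3))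
  · rw [hBtsum ⟨z, hz⟩ v y hr, hΛz]
    exact (ENNReal.ofReal_toReal (hVfin ⟨z, hz⟩)).symm

/-- The norming form `B` may be replaced by the canonical extension `B'` of its restriction to `E* ×
X`, since their difference has trace zero. The constant of `B'` is `1`, so the bound is independent
of `k`. -/
theorem splittingNorm_le_of_rep [CompleteSpace X] [IsOrderedAddMonoid X] [PosSMulMono ℝ X]
    (hX : ∀ a b : StrongDual ℝ X, 0 ≤ a → 0 ≤ b → ‖a‖ ≤ ‖a + b‖)
    (hp : 1 ≤ p)
    (h : HasAP (StrongDual ℝ E) ∨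
      HasPMAP (StrongDual ℝ (StrongDual ℝ (StrongDual ℝ (StrongDual ℝ X)))))
    {k : ℝ} (hk : 0 ≤ k) {S : E →L[ℝ] X} {v : ℕ → StrongDual ℝ E}
    {φ : ℕ → StrongDual ℝ (StrongDual ℝ X)}
    (hr : IsLatticiallyNuclearRep p (inclusionInDoubleDual ℝ X ∘L S) v φ) :
    splittingNorm p (ENNReal.ofReal k) (inclusionInDoubleDual ℝ X)
        (inclusionInDoubleDual ℝ X ∘L S)
      ≤ strongNorm p v * weakNorm p.conjExponent φ := by
  obtain ⟨B, hB, hB0, hBz⟩ := exists_form_splittingNorm hp (by norm_num)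
    (latticiallyNuclearNorm_tensorOp_dual_le (p := p) hp hX)
    (NormedSpace.inclusionInDoubleDual_norm_le ℝ X) inclusionInDoubleDual_isPositiveOp hk
    ((latticiallyNuclearNorm_le hr).trans_lt
      (ENNReal.mul_lt_top hr.summable_left.1 hr.summable_right))
  obtain ⟨B', hB', hBB'⟩ : ∃ B' : StrongDual ℝ E →L[ℝ] _, IsBoundedForm p 1 B' ∧
      ∀ f x, B' f (inclusionInDoubleDual ℝ X x) = B f (inclusionInDoubleDual ℝ X x) :=
    ⟨_, hB0.bidual hp zero_le_one, fun _ _ => rfl⟩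
  have hA0 : 0 ≤ (strongNorm p v).toReal := ENNReal.toReal_nonneg
  have hW0 : 0 ≤ (weakNorm p.conjExponent φ).toReal := ENNReal.toReal_nonneg
  have hAe := ENNReal.ofReal_toReal hr.summable_left.1.ne
  have hWe := ENNReal.ofReal_toReal (ne_of_lt hr.summable_right)
  have hzero : ∑' j, (B - B') (v j) (φ j) = 0 :=
    tsum_form_eq_zero_of_vanish hp h (add_nonneg hk zero_le_one) (hB.sub hp hB')
      (fun f x => by
        rw [sub_apply, sub_apply, hBB', sub_self]) hr
  simp only [sub_apply] at hzero
  rw [(hB.summable hA0 hW0 hAe.ge hWe.ge hr.nonneg).tsum_sub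
    (hB'.summable hA0 hW0 hAe.ge hWe.ge hr.nonneg), sub_eq_zero] at hzero
  rw [hBz v φ hr, hzero, ← hAe, ← hWe, ← ENNReal.ofReal_mul hA0]
  refine ENNReal.ofReal_le_ofReal ((le_abs_self _).trans ?_)
  exact (hB'.abs_tsum_le hp hA0 hW0 hAe.ge hWe.ge hr.nonneg).trans_eq (by rw [one_mul])

theorem exists_splitting [CompleteSpace X] [IsOrderedAddMonoid X] [PosSMulMono ℝ X]
    (hX : ∀ a b : StrongDual ℝ X, 0 ≤ a → 0 ≤ b → ‖a‖ ≤ ‖a + b‖)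
    (hp : 1 ≤ p)
    (h : HasAP (StrongDual ℝ E) ∨
      HasPMAP (StrongDual ℝ (StrongDual ℝ (StrongDual ℝ (StrongDual ℝ X)))))
    {S : E →L[ℝ] X} {M δ : ℝ} (hM : 0 < M) (hδ : 0 < δ)
    (hS : latticiallyNuclearNorm p (inclusionInDoubleDual ℝ X ∘L S) < ENNReal.ofReal M) :
    ∃ s : E →L[ℝ] X, latticiallyNuclearNorm p s < ENNReal.ofReal M ∧
      latticiallyNuclearNorm p (inclusionInDoubleDual ℝ X ∘L (S - s)) < ENNReal.ofReal δ := by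
  obtain ⟨v, hS⟩ := iInf_lt_iff.1 hS
  obtain ⟨φ, hS⟩ := iInf_lt_iff.1 hS
  obtain ⟨hr, hS⟩ := iInf_lt_iff.1 hS
  -- With weight `M / δ` on the remainder, a total below `M` forces the remainder below `δ`.
  have hk : 0 < M / δ := by positivity
  obtain ⟨s, hs⟩ := iInf_lt_iff.1 ((splittingNorm_le_of_rep hX hp h hk.le hr).trans_lt hS)
  refine ⟨s, le_self_add.trans_lt hs, ?_⟩
  have h1 := le_add_self.trans_lt hs
  rw [ContinuousLinearMap.comp_sub]
  by_contra! hcon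
  refine h1.not_ge ?_
  calc ENNReal.ofReal M = ENNReal.ofReal (M / δ) * ENNReal.ofReal δ := by
        rw [← ENNReal.ofReal_mul hk.le, div_mul_cancel₀ _ hδ.ne']
    _ ≤ _ := by gcongr

/-- Successive approximation: the remainder in `X**` left by one splitting is itself `J` composed
with an operator into `X`, so it can be split again. -/
theorem latticiallyNuclearNorm_le_bidual [CompleteSpace X] [IsOrderedAddMonoid X]
    [PosSMulMono ℝ X] (hX : ∀ a b : StrongDual ℝ X, 0 ≤ a → 0 ≤ b → ‖a‖ ≤ ‖a + b‖)
    (hp : 1 ≤ p)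
    (h : HasAP (StrongDual ℝ E) ∨
      HasPMAP (StrongDual ℝ (StrongDual ℝ (StrongDual ℝ (StrongDual ℝ X)))))
    (S : E →L[ℝ] X) :
    latticiallyNuclearNorm p S ≤ latticiallyNuclearNorm p (inclusionInDoubleDual ℝ X ∘L S) := by
  suffices key : ∀ M δ : ℝ, 0 < M → 0 < δ →
      latticiallyNuclearNorm p (inclusionInDoubleDual ℝ X ∘L S) < ENNReal.ofReal M →
      latticiallyNuclearNorm p S ≤ ENNReal.ofReal ((1 + δ) * (M + δ)) by
    refine ENNReal.le_of_forall_pos_le_add fun ε hε hfin => ?_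
    have hε' : (0 : ℝ) < ε := hε
    set m := (latticiallyNuclearNorm p (inclusionInDoubleDual ℝ X ∘L S)).toReal
    have hm0 : 0 ≤ m := ENNReal.toReal_nonneg
    have hme : ENNReal.ofReal m
        = latticiallyNuclearNorm p (inclusionInDoubleDual ℝ X ∘L S) :=
      ENNReal.ofReal_toReal hfin.ne
    rw [← hme, ← ENNReal.ofReal_coe_nnreal, ← ENNReal.ofReal_add hm0 hε'.le]
    have hlim : Filter.Tendsto (fun δ : ℝ => ENNReal.ofReal ((1 + δ) * ((m + ε) + δ)))
        (nhdsWithin 0 (Set.Ioi 0)) (nhds (ENNReal.ofReal ((1 + 0) * ((m + ε) + 0)))) :=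
      (Continuous.tendsto (ENNReal.continuous_ofReal.comp (by fun_prop)) 0).mono_left
        nhdsWithin_le_nhds
    have := ge_of_tendsto hlim (by
      filter_upwards [self_mem_nhdsWithin] with δ hδ using
        key (m + ε) δ (by positivity) hδ (by
          rw [← hme, ENNReal.ofReal_lt_ofReal_iff (by positivity)]
          linarith))
    simpa using this
  intro M δ hM hδ hS
  set J := inclusionInDoubleDual ℝ X with hJ
  have hgeo : HasSum (fun k : ℕ => δ / 2 / 2 ^ k) δ := hasSum_geometric_two' δ
  -- Budgets for the strong and weak factors of the `k`-th piece. Their sums `1 + δ` and `M + δ`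
  -- bound the corresponding `ℓ_p` norms for every exponent, and `α 0 * β 0 ≥ M` starts the
  -- iteration.
  set α : ℕ → ℝ := fun k => (if k = 0 then 1 else 0) + δ / 2 / 2 ^ k with hα
  set β : ℕ → ℝ := fun k => (if k = 0 then M else 0) + δ / 2 / 2 ^ k with hβ
  have hαs : HasSum α (1 + δ) := (hasSum_ite_eq 0 1).add hgeo
  have hβs : HasSum β (M + δ) := (hasSum_ite_eq 0 M).add hgeo
  have hα0 : ∀ k, 0 < α k := fun k => by
    simp only [hα]
    split_ifs <;> positivity
  have hβ0 : ∀ k, 0 < β k := fun k => by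
    simp only [hβ]
    split_ifs <;> positivity
  have hm0 : ∀ k, 0 < α k * β k := fun k => mul_pos (hα0 k) (hβ0 k)
  have hms : Summable fun k => α k * β k :=
    Summable.of_nonneg_of_le (fun k => (hm0 k).le) (fun k =>
      mul_le_mul_of_nonneg_right (le_hasSum hαs k fun j _ => (hα0 j).le) (hβ0 k).le)
      (hβs.summable.mul_left (1 + δ))
  have hstep : ∀ (k : ℕ) (R : E →L[ℝ] X), ∃ R' : E →L[ℝ] X,
      latticiallyNuclearNorm p (J ∘L R) < ENNReal.ofReal (α k * β k) →
      latticiallyNuclearNorm p (R - R') < ENNReal.ofReal (α k * β k) ∧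
      latticiallyNuclearNorm p (J ∘L R') < ENNReal.ofReal (α (k + 1) * β (k + 1)) := by
    intro k R
    by_cases hR : latticiallyNuclearNorm p (J ∘L R) < ENNReal.ofReal (α k * β k)
    · obtain ⟨s, h1, h2⟩ := exists_splitting hX hp h (hm0 k) (hm0 (k + 1)) hR
      exact ⟨R - s, fun _ => ⟨by rwa [sub_sub_cancel], h2⟩⟩
    -- Default value, never reached: the smallness condition holds along the whole iteration.
    · exact ⟨0, fun h => absurd h hR⟩
  choose next hnext using hstep
  let R : ℕ → E →L[ℝ] X := fun k => Nat.rec S next k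
  have hR0 : R 0 = S := rfl
  have hRs : ∀ k, R (k + 1) = next k (R k) := fun k => rfl
  have hR : ∀ k, latticiallyNuclearNorm p (J ∘L R k) < ENNReal.ofReal (α k * β k) := by
    intro k
    induction k with
    | zero =>
      refine hS.trans_le (ENNReal.ofReal_le_ofReal ?_)
      simp only [hα, hβ, if_true, pow_zero, div_one]
      nlinarith
    | succ k ih => exact (hnext k (R k) ih).2
  have hs : ∀ k, latticiallyNuclearNorm p (R k - R (k + 1)) < ENNReal.ofReal (α k * β k) :=
    fun k => (hnext k (R k) (hR k)).1
  have hnorm : ∀ {Z : Type _} [NormedAddCommGroup Z] [NormedSpace ℝ Z] [Preorder Z]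
      (t : E →L[ℝ] Z) (c : ℝ), 0 < c → latticiallyNuclearNorm p t < ENNReal.ofReal c → ‖t‖ ≤ c := by
    intro Z _ _ _ t c hc ht
    have := (enorm_le_latticiallyNuclearNorm hp t).trans ht.le
    rwa [← ofReal_norm, ENNReal.ofReal_le_ofReal_iff hc.le] at this
  -- Only `J ∘ R k` is known to be small in nuclear norm; as `J` is isometric, this still makes `R
  -- k` small in operator norm, and the differences telescope to `S`.
  have hRlim : Filter.Tendsto R Filter.atTop (nhds 0) := by
    refine squeeze_zero_norm (fun k => ?_) hms.tendsto_atTop_zero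
    rw [← norm_inclusionInDoubleDual_comp]
    exact hnorm _ _ (hm0 k) (hR k)
  have hsum : HasSum (fun k => R k - R (k + 1)) S := by
    have h1 : Summable fun k => R k - R (k + 1) :=
      Summable.of_norm_bounded hms fun k => hnorm _ _ (hm0 k) (hs k)
    have h2 : Filter.Tendsto (fun n => ∑ k ∈ Finset.range n, (R k - R (k + 1)))
        Filter.atTop (nhds S) := by
      simp_rw [Finset.sum_range_sub']
      simpa [hR0] using (tendsto_const_nhds (x := R 0)).sub hRlim
    rw [← tendsto_nhds_unique h1.hasSum.tendsto_sum_nat h2]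
    exact h1.hasSum
  choose u x hr hu hx using fun k => exists_rep_of_norm_lt hp (hα0 k) (hβ0 k) (hs k)
  have hαle : lpSum p (fun k => ENNReal.ofReal (α k)) ≤ ENNReal.ofReal (1 + δ) := by
    refine (lpSum_le_tsum hp _).trans_eq ?_
    rw [← ENNReal.ofReal_tsum_of_nonneg (fun k => (hα0 k).le) hαs.summable, hαs.tsum_eq]
  have hβle : lpSum p.conjExponent (fun k => ENNReal.ofReal (β k)) ≤ ENNReal.ofReal (M + δ) := by
    refine (lpSum_le_tsum (one_le_conjExponent p) _).trans_eq ?_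
    rw [← ENNReal.ofReal_tsum_of_nonneg (fun k => (hβ0 k).le) hβs.summable, hβs.tsum_eq]
  obtain ⟨u', x', hr', hu', hx'⟩ := exists_rep_of_hasSum hp hsum hr hu hx
    (hαle.trans_lt ENNReal.ofReal_lt_top)
    (fun _ => by
      have := ENNReal.tendsto_ofReal hαs.summable.tendsto_cofinite_zero
      rwa [ENNReal.ofReal_zero] at this)
    (hβle.trans_lt ENNReal.ofReal_lt_top)
  rw [ENNReal.ofReal_mul (by positivity)]
  exact (latticiallyNuclearNorm_le hr').trans (mul_le_mul' (hu'.trans hαle) (hx'.trans hβle))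

end Splitting

end BanachLattice

theorem mainTheorem4
    {E : Type*} [NormedAddCommGroup E] [NormedSpace ℝ E] [CompleteSpace E]
    {X : Type*} [NormedAddCommGroup X] [NormedSpace ℝ X] [CompleteSpace X]
    [Lattice X] [IsOrderedAddMonoid X] [IsOrderedModule ℝ X] [HasSolidNorm X]
    (p : ENNReal) (hp : 1 ≤ p)
    (h : BanachLattice.HasAP (StrongDual ℝ E) ∨
      BanachLattice.HasPMAP
        (StrongDual ℝ (StrongDual ℝ (StrongDual ℝ (StrongDual ℝ X)))))
    (S : E →L[ℝ] X)
    (hS : BanachLattice.IsPositivelyNuclear p (BanachLattice.adjointOp S)) :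
    BanachLattice.IsLatticiallyNuclear p S ∧
      BanachLattice.latticiallyNuclearNorm p S =
        BanachLattice.positivelyNuclearNorm p (BanachLattice.adjointOp S) := by
  rw [BanachLattice.positivelyNuclearNorm_adjointOp]
  have hle := BanachLattice.latticiallyNuclearNorm_le_bidual
    BanachLattice.dual_norm_mono hp h S
  -- The reverse inequality is composition with the positive contraction `J`; nuclearity of `S`
  -- follows from finiteness of the norm of `J ∘ S`.
  refine ⟨BanachLattice.isLatticiallyNuclear_of_lt_top (hle.trans_lt ?_), hle.antisymm
    (BanachLattice.latticiallyNuclearNorm_comp_le S _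
      (NormedSpace.inclusionInDoubleDual_norm_le ℝ X)
      BanachLattice.inclusionInDoubleDual_isPositiveOp)⟩
  obtain ⟨φ, v, hr⟩ := hS
  have hr' := BanachLattice.isPositivelyNuclearRep_adjointOp_iff.1 hr
  exact (BanachLattice.latticiallyNuclearNorm_le hr').trans_lt
    (ENNReal.mul_lt_top hr'.summable_left.1 hr'.summable_right)
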